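/- **Setting.** Fix integers $m,p\ge 1$, put $q=m+p$, and write signals as $w=(u,y):\mathbb Z_+\to\mathbb R^q$ with $u(t)\in\mathbb R^m$, $y(t)\in\mathbb R^p$. Let $\mathbb S^k$ denote the real symmetric $k\times k$ matrices and let $M\ge 0$ mean that $M$ is positive semidefinite. *Behaviors.* $\mathfrak L_{m,p}$ is the set of all behaviors $\mathfrak B=\{(u,y)\mid \exists\, x:\mathbb Z_+\to\mathbb R^n:\ x(t+1)=Ax(t)+Bu(t),\ y(t)=Cx(t)+Du(t)\ \forall t\in\mathbb Z_+\}$ with $n\ge 0$ and real matrices $A,B,C,D$. Let $n(\mathfrak B)$ be the smallest such $n$, and let the lag $\ell(\mathfrak B)$ be the smallest $k\ge 0$ with $\operatorname{rank}\mathcal O_k=\operatorname{rank}\mathcal O_{k+1}$, where $\mathcal O_k$ has block rows $C,CA,\dots,CA^{k-1}$ (this does not depend on the representation). $\mathfrak B$ is controllable if for all $w_1,w_2\in\mathfrak B$ and $t_1\in\mathbb Z_+$ there are $w\in\mathfrak B$ and $t_2\ge t_1$ with $w(t)=w_1(t)$ for $t\in[0,t_1]$ and $w(t)=w_2(t-t_2)$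 for $t\ge t_2$. For $L\ge 0$, $\mathfrak L^{\rm cont}_{m,p,L}$ is the set of controllable $\mathfrak B\in\mathfrak L_{m,p}$ with $\ell(\mathfrak B)\le L$. *Quadratic difference forms.* A symmetric matrix $\Psi=(\Psi_{i,j})_{i,j=0}^{M}\in\mathbb S^{(M+1)q}$, $M\ge -1$, with $q\times q$ blocks defines $Q_\Psi(w)(t)=\sum_{i,j=0}^{M}w(t+i)^\top\Psi_{i,j}\,w(t+j)$. Its degree $\deg(Q_\Psi)$ is the smallest integer $d\ge -1$ with $\Psi_{i,j}=0$ for all $i>d$ and all $j$; $\Psi$ is minimal if $M=\deg (Q_\Psi)$. Put $\nabla\Psi=\begin{bmatrix}0_{q,q}&0\\0&\Psi\end{bmatrix}-\begin{bmatrix}\Psi&0\\0&0_{q,q}\end{bmatrix}$, so that $Q_{\nabla\Psi}(w)(t)=Q_\Psi(w)(t+1)-Q_\Psi(w)(t)$. (In)equalities between QDFs "on $\mathfrak B$" are required for all $w\in\mathfrak B$ and $t\in\mathbb Z_+$. $Q_\Psi$ is a storage function for $(\mathfrak B,Q_\Phi)$ if $Q_\Psi\ge 0$ on $\mathfrak B$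 and $Q_{\nabla\Psi}\le Q_\Phi$ on $\mathfrak B$. *Data.* Let $Q_\Phi$ be a QDF with minimal coefficient matrix $\Phi$, let $L\ge 0$ and $d=\max\{\deg(Q_\Phi),L\}$. Let $\mathfrak B_*\in\mathfrak L^{\rm cont}_{m,p,L}$ and let $w_{[0,T-1]}$ be the restriction to $[0,T-1]$ of an element of $\mathfrak B_*$, where $T\ge d+1$. Let $\Sigma$ be the set of all $\mathfrak B\in\mathfrak L_{m,p}$ that contain a signal whose restriction to $[0,T-1]$ is $w_{[0,T-1]}$, let $n_{\min}=\min\{n(\mathfrak B)\mid\mathfrak B\in\Sigma\}$, and let $H$ be the Hankel matrix of depth $d+1$ of the data, with columns $w_{[t,t+d]}$, $t=0,\dots,T-d-1$. The data are *informative for dissipativity* with respect to $Q_\Phi$ if there is a single $\Psi\ge 0$ in $\mathbb S^{qd}$ such that $Q_{\nabla\Psi}\le Q_\Phi$ on $\mathfrak B$ for all $\mathfrak B\in\Sigma\cap\mathfrak L^{\rm cont}_{m,p,L}$. **Theorem.** Consider, for $\Psi\in\mathbb S^{qd}$, the inequality $$H^\top\left(\begin{bmatrix}\Psi&0\\0&0_{q,q}\end{bmatrix}-\begin{bmatrix}0_{q,q}&0\\0&\Psi\end{bmatrix}+\begin{bmatrix}\Phi&0\\0&0\end{bmatrix}\right)H\ge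 0.\tag{1}$$ (i) If $\operatorname{rank}H=n_{\min}+m(d+1)$ and some $\Psi\ge 0$ in $\mathbb S^{qd}$ satisfies (1), then the data are informative for dissipativity with respect to $Q_\Phi$. Moreover, in this case, $Q_\Psi$ is a storage function for $(\mathfrak B_*,Q_\Phi)$. (ii) Assume in addition to the setting that $Q_\Phi$ is static, i.e. $\deg(Q_\Phi)=0$ (so $d=L$), that $\Phi=\begin{bmatrix}\Phi_{11}&\Phi_{12}\\\Phi_{21}&\Phi_{22}\end{bmatrix}\in\mathbb S^q$ with $\Phi_{11}\in\mathbb S^m$, $\Phi_{22}\in\mathbb S^p$ has $p$ negative, no zero and $m$ positive eigenvalues (counted with multiplicity), and that $-\Phi_{22}\ge 0$. Then the data are informative for dissipativity with respect to $Q_\Phi$ if and only if $\operatorname{rank}H=n_{\min}+m(L+1)$ and there exists $\Psi\ge 0$ in $\mathbb S^{qL}$ satisfying (1). -/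

import Mathlib

open Matrix

namespace DataDissipativity

/-! Signals, state-space systems and behaviors. The external variable is `w = (u, y)` with `m` inputs
and `p` outputs; its `q = m + p` components are indexed by `Fin m ⊕ Fin p`. -/

/-- Index set of the external variables: inputs on the left, outputs on the right. -/
abbrev Var (m p : ℕ) : Type := Fin m ⊕ Fin p

/-- Signals `w : ℤ₊ → ℝ^q`. -/
abbrev Signal (m p : ℕ) : Type := ℕ → Var m p → ℝ

/-- The matrices of a system `x(t+1) = A x(t) + B u(t)`, `y(t) = C x(t) + D u(t)` with
`n` states, `m` inputs and `p` outputs (`n = 0` is allowed). -/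
structure StateSpace (m p n : ℕ) where
  A : Matrix (Fin n) (Fin n) ℝ
  B : Matrix (Fin n) (Fin m) ℝ
  C : Matrix (Fin p) (Fin n) ℝ
  D : Matrix (Fin p) (Fin m) ℝ

namespace StateSpace

variable {m p n : ℕ}

/-- `x` is a state trajectory of the system that is compatible with `w = (u, y)`. -/
def IsTrajectory (S : StateSpace m p n) (x : ℕ → Fin n → ℝ) (w : Signal m p) : Prop :=
  ∀ t, x (t + 1) = S.A *ᵥ x t + S.B *ᵥ (fun i => w t (Sum.inl i)) ∧
    (fun i => w t (Sum.inr i)) = S.C *ᵥ x t + S.D *ᵥ (fun i => w t (Sum.inl i))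

/-- The input-output behavior of the system. -/
def behavior (S : StateSpace m p n) : Set (Signal m p) :=
  {w | ∃ x : ℕ → Fin n → ℝ, S.IsTrajectory x w}

/-- The `k`-th observability matrix: the blocks `C, C A, …, C A^(k-1)` stacked. -/
def observability (S : StateSpace m p n) (k : ℕ) : Matrix (Fin k × Fin p) (Fin n) ℝ :=
  Matrix.of fun r j => (S.C * S.A ^ (r.1 : ℕ)) r.2 j

/-- The lag of the pair `(C, A)`: the smallest `k ≥ 0` with `rank 𝒪_k = rank 𝒪_{k+1}`. -/
noncomputable def lag (S : StateSpace m p n) : ℕ :=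
  sInf {k : ℕ | (S.observability k).rank = (S.observability (k + 1)).rank}

theorem mem_range_observability (S : StateSpace m p n) (k : ℕ) (v : Fin k × Fin p → ℝ) :
    v ∈ LinearMap.range (S.observability k).mulVecLin ↔
      ∃ w ∈ S.behavior, (∀ t i, w t (Sum.inl i) = 0) ∧ ∀ r, v r = w r.1 (Sum.inr r.2) := by
  constructor
  · rintro ⟨x0, rfl⟩
    refine ⟨fun t => Sum.elim 0 (S.C *ᵥ ((S.A ^ t) *ᵥ x0)),
      ⟨fun t => (S.A ^ t) *ᵥ x0, fun t => ⟨?_, ?_⟩⟩, fun t i => rfl, fun r => ?_⟩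
    · ext i
      have h0 : (fun _ : Fin m => (0 : ℝ)) = 0 := rfl
      simp [pow_succ', Matrix.mulVec_mulVec, h0]
    · ext i
      simp [Matrix.mulVec, dotProduct]
    · simp only [Sum.elim_inr, Matrix.mulVec_mulVec]
      simp [observability, Matrix.mulVec, dotProduct]
  · rintro ⟨w, ⟨x, hx⟩, hu, hv⟩
    have h0 : ∀ t, (fun i => w t (Sum.inl i)) = (0 : Fin m → ℝ) := fun t => funext (hu t)
    have hxt : ∀ t, x t = (S.A ^ t) *ᵥ x 0 := by
      intro t
      induction t with
      | zero => simp
      | succ t ih =>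
        rw [(hx t).1, h0 t, ih, pow_succ', ← Matrix.mulVec_mulVec]
        simp
    refine ⟨x 0, funext fun r => ?_⟩
    have h2 := congrFun (hx r.1).2 r.2
    rw [hv r, h2, h0, hxt r.1, Matrix.mulVec_mulVec]
    simp [observability, Matrix.mulVec, dotProduct]

/-- The lag depends on the behavior only. -/
theorem lag_eq_of_behavior_eq {n' : ℕ} (S : StateSpace m p n) (S' : StateSpace m p n')
    (h : S.behavior = S'.behavior) : S.lag = S'.lag := by
  have hr : ∀ k, (S.observability k).rank = (S'.observability k).rank := by
    intro k
    have : LinearMap.range (S.observability k).mulVecLin =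
        LinearMap.range (S'.observability k).mulVecLin := by
      ext v
      rw [mem_range_observability, mem_range_observability, h]
    rw [Matrix.rank, Matrix.rank, this]
  simp only [lag, hr]

end StateSpace

variable {m p : ℕ}

/-- The set of all LTI behaviors with `m` inputs and `p` outputs. -/
def LTI (m p : ℕ) : Set (Set (Signal m p)) :=
  {𝔅 | ∃ (n : ℕ) (S : StateSpace m p n), S.behavior = 𝔅}

/-- `n(𝔅)`: the state-space dimension of a minimal state-space representation of `𝔅`. -/
noncomputable def stateDim (𝔅 : Set (Signal m p)) : ℕ :=
  sInf {n : ℕ | ∃ S : StateSpace m p n, S.behavior = 𝔅}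

/-- `ℓ(𝔅)`: the lag of any state-space representation of `𝔅` (they all have the same lag). -/
noncomputable def lag (𝔅 : Set (Signal m p)) : ℕ :=
  sInf {l : ℕ | ∃ (n : ℕ) (S : StateSpace m p n), S.behavior = 𝔅 ∧ S.lag = l}

theorem lag_behavior {n : ℕ} (S : StateSpace m p n) : lag S.behavior = S.lag := by
  have : {l : ℕ | ∃ (n' : ℕ) (S' : StateSpace m p n'), S'.behavior = S.behavior ∧ S'.lag = l}
      = {S.lag} := by
    ext l
    constructor
    · rintro ⟨n', S', h, rfl⟩
      exact StateSpace.lag_eq_of_behavior_eq S' S h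
    · rintro rfl
      exact ⟨n, S, rfl, rfl⟩
  rw [lag, this, csInf_singleton]

/-- Controllability of a behavior with time axis `ℤ₊`. -/
def Controllable (𝔅 : Set (Signal m p)) : Prop :=
  ∀ w₁ ∈ 𝔅, ∀ w₂ ∈ 𝔅, ∀ t₁ : ℕ, ∃ w ∈ 𝔅, ∃ t₂ : ℕ, t₁ ≤ t₂ ∧
    (∀ t, t ≤ t₁ → w t = w₁ t) ∧ ∀ t, t₂ ≤ t → w t = w₂ (t - t₂)

/-- Controllable LTI behaviors with `m` inputs, `p` outputs and lag at most `L`. -/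
def LTIContLag (m p L : ℕ) : Set (Set (Signal m p)) :=
  {𝔅 | 𝔅 ∈ LTI m p ∧ Controllable 𝔅 ∧ lag 𝔅 ≤ L}

/-! Quadratic difference forms. -/

/-- Square matrices with `N × N` blocks of size `q × q`, where `q = m + p`; the entry `(a, b)` of the
block `Ψ_{i,j}` is `Ψ (i, a) (j, b)`. A QDF with `M = N - 1` has such a coefficient matrix. -/
abbrev Coeff (m p N : ℕ) : Type := Matrix (Fin N × Var m p) (Fin N × Var m p) ℝ

/-- The vector `w_{[t, t+N-1]}`. -/
def window (N : ℕ) (w : Signal m p) (t : ℕ) : Fin N × Var m p → ℝ :=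
  fun r => w (t + (r.1 : ℕ)) r.2

/-- The quadratic difference form `Q_Ψ(w)(t) = w_{[t,t+N-1]}ᵀ Ψ w_{[t,t+N-1]}`; zero if `N = 0`. -/
def qdf {N : ℕ} (Ψ : Coeff m p N) (w : Signal m p) (t : ℕ) : ℝ :=
  window N w t ⬝ᵥ (Ψ *ᵥ window N w t)

/-- The degree of `Q_Ψ`: the smallest integer `d ≥ -1` with `Ψ_{i,j} = 0` for all `i > d`, all `j`. -/
noncomputable def qdfDegree {N : ℕ} (Ψ : Coeff m p N) : ℤ :=
  sInf {d : ℤ | -1 ≤ d ∧ ∀ i j : Fin N, d < (i : ℤ) → ∀ a b : Var m p, Ψ (i, a) (j, b) = 0}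

/-- `Ψ` is a minimal coefficient matrix: it is symmetric and has `deg(Q_Ψ) + 1` block rows. -/
def IsMinimalCoeff {N : ℕ} (Ψ : Coeff m p N) : Prop :=
  Ψ.IsHermitian ∧ (N : ℤ) = qdfDegree Ψ + 1

/-- The matrix `[Ψ 0; 0 0]` with `k × k` blocks (used for `k ≥ N`). -/
def padEnd {N : ℕ} (k : ℕ) (Ψ : Coeff m p N) : Coeff m p k :=
  Matrix.of fun r s =>
    if h : (r.1 : ℕ) < N ∧ (s.1 : ℕ) < N then Ψ (⟨r.1, h.1⟩, r.2) (⟨s.1, h.2⟩, s.2) else 0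

/-- The matrix `[0_{q,q} 0; 0 Ψ]`. -/
def padStart {N : ℕ} (Ψ : Coeff m p N) : Coeff m p (N + 1) :=
  Matrix.of fun r s =>
    Fin.cases 0 (fun i => Fin.cases 0 (fun j => Ψ (i, r.2) (j, s.2)) s.1) r.1

/-- The coefficient matrix `∇Ψ = [0 0; 0 Ψ] - [Ψ 0; 0 0]` of the rate of change of `Q_Ψ`. -/
def nabla {N : ℕ} (Ψ : Coeff m p N) : Coeff m p (N + 1) :=
  padStart Ψ - padEnd (N + 1) Ψ

/-- The dissipation inequality `Q_{∇Ψ} ≤ Q_Φ` on `𝔅`. -/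
def DissipationIneq {N d : ℕ} (𝔅 : Set (Signal m p)) (Φ : Coeff m p N) (Ψ : Coeff m p d) : Prop :=
  ∀ w ∈ 𝔅, ∀ t, qdf (nabla Ψ) w t ≤ qdf Φ w t

/-- `Q_Ψ` is a storage function for `(𝔅, Q_Φ)`. -/
def IsStorage {N d : ℕ} (𝔅 : Set (Signal m p)) (Φ : Coeff m p N) (Ψ : Coeff m p d) : Prop :=
  Ψ.IsHermitian ∧ (∀ w ∈ 𝔅, ∀ t, 0 ≤ qdf Ψ w t) ∧ DissipationIneq 𝔅 Φ Ψ

/-! Data. -/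

/-- The restricted behavior `𝔅|_{[0, T-1]}`. -/
def restrict (T : ℕ) (𝔅 : Set (Signal m p)) : Set (Fin T → Var m p → ℝ) :=
  {v | ∃ w ∈ 𝔅, ∀ t : Fin T, v t = w t}

/-- `Σ`: the LTI behaviors that are consistent with the data. -/
def consistent {T : ℕ} (data : Fin T → Var m p → ℝ) : Set (Set (Signal m p)) :=
  {𝔅 | 𝔅 ∈ LTI m p ∧ data ∈ restrict T 𝔅}

/-- `n_min`: the smallest state-space dimension of a behavior consistent with the data. -/
noncomputable def nMin {T : ℕ} (data : Fin T → Var m p → ℝ) : ℕ :=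
  sInf {n : ℕ | ∃ 𝔅 ∈ consistent data, stateDim 𝔅 = n}

/-- The Hankel matrix of depth `k ≤ T` of the data, with `k` block rows and `T - k + 1` columns. -/
def hankel {T : ℕ} (data : Fin T → Var m p → ℝ) (k : ℕ) (hk : k ≤ T) :
    Matrix (Fin k × Var m p) (Fin (T - k + 1)) ℝ :=
  Matrix.of fun r c => data ⟨(r.1 : ℕ) + (c : ℕ), by have := r.1.2; have := c.2; omega⟩ r.2

/-- `d = max {deg(Q_Φ), L}`; the maximum is nonnegative since `L` is. -/
noncomputable def horizon {N : ℕ} (Φ : Coeff m p N) (L : ℕ) : ℕ :=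
  (max (qdfDegree Φ) (L : ℤ)).toNat

/-- The data are informative for dissipativity with respect to `Q_Φ`, given that the true behavior
is controllable with lag at most `L`: one positive semidefinite `Ψ ∈ 𝕊^{q d}` satisfies the
dissipation inequality on all behaviors that are consistent with data and prior knowledge. -/
def Informative {N T : ℕ} (L : ℕ) (Φ : Coeff m p N) (data : Fin T → Var m p → ℝ) : Prop :=
  ∃ Ψ : Coeff m p (horizon Φ L), Ψ.PosSemidef ∧
    ∀ 𝔅 ∈ consistent data ∩ LTIContLag m p L, DissipationIneq 𝔅 Φ Ψ

/-- The linear matrix inequality `Hᵀ ([Ψ 0; 0 0] - [0 0; 0 Ψ] + [Φ 0; 0 0]) H ≥ 0`, where `H` has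
`d + 1` block rows. -/
def DataLMI {N d : ℕ} {κ : Type} (H : Matrix (Fin (d + 1) × Var m p) κ ℝ)
    (Φ : Coeff m p N) (Ψ : Coeff m p d) : Prop :=
  (Hᵀ * (padEnd (d + 1) Ψ - padStart Ψ + padEnd (d + 1) Φ) * H).PosSemidef

/-- The real symmetric matrix `M` has `a` negative, `b` zero and `c` positive eigenvalues, counted
with multiplicity. -/
def HasInertia {ι : Type} [Fintype ι] [DecidableEq ι] (M : Matrix ι ι ℝ) (a b c : ℕ) : Prop :=
  ∃ h : M.IsHermitian, Nat.card {i // h.eigenvalues i < 0} = a ∧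
    Nat.card {i // h.eigenvalues i = 0} = b ∧ Nat.card {i // 0 < h.eigenvalues i} = c

/-- The lower right `p × p` block `Φ_22` of `Φ ∈ 𝕊^q`, `q = m + p`. -/
def outputBlock (Φ : Coeff m p 1) : Matrix (Fin p) (Fin p) ℝ :=
  Matrix.of fun i j => Φ (0, Sum.inr i) (0, Sum.inr j)

end DataDissipativity

open DataDissipativity

/-! Everything is read off windows of length d+1. The columns of H are windows of every consistent
behavior, and a system with n states has a window space of dimension at most n + m(d+1), because a
window is a function of the initial state and of d+1 inputs.

Sufficiency. The rank condition forces range H to be the full window space of a consistent system of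
least dimension. A behavior of lag at most d is determined by its windows of length d+1, so each
admissible behavior contains that least one. A controllable behavior has no proper sub-behavior with
the same free inputs, hence the two coincide (`range_hankel_eq_windowSpace`). On that window space
(1) is the dissipation inequality.

Necessity. The inequality (1) only needs range H to lie in the windows of one consistent behavior.
For the rank, suppose that a window of the true behavior lies outside range H, and let η be a
functional that vanishes on range H but not on this window. Embed the behavior in the kernel of a
difference operator R of order L that is monic in the output. The equations R w + α η(w) = 0 again
explain the data and have lag at most L, for every vector α. If they are controllable for almost all
α, then the slack of the dissipation inequality is nonnegative on their windows. Any window v with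
η(v) ≠ 0 solves the equations with α = -R v / η(v), so by continuity the slack is nonnegative on all
windows, and an impulse then gives Φ ≥ 0 (`posSemidef_of_slack_nonneg`). This contradicts the
negative eigenvalues of Φ.

Generic controllability is the main point. The kernel of R is in general larger than the behavior; R
is chosen so that the surplus consists of real exponential outputs with distinct exponents that
avoid the resonances of η, a finite set by `finite_resonances`. By a Hautus-type test, loss of
controllability means a functional with an autonomous law z(t+1) = μ z(t). Here μ can only be one of
these exponents or a resonance, and each of these finitely many cases is excluded for all α outside
a proper affine subspace (`ae_isGood`, `controllable_perturb`). -/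

namespace DataDissipativity

open MeasureTheory

variable {m p n L : ℕ}

/-! ### Windows, shifts and concatenations of signals -/

/-- The signal `t ↦ w (t + s)`. -/
def shift (s : ℕ) (w : Signal m p) : Signal m p := fun t => w (t + s)

/-- The signal that follows `w₁` before time `s` and `w₂`, started at time `s`, from then on. -/
def concat (s : ℕ) (w₁ w₂ : Signal m p) : Signal m p := fun t => if t < s then w₁ t else w₂ (t - s)

/-- `window` as a linear map. -/
def windowMap (k t : ℕ) : Signal m p →ₗ[ℝ] (Fin k × Var m p → ℝ) where
  toFun w := window k w t
  map_add' _ _ := rfl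
  map_smul' _ _ := rfl

@[simp] theorem windowMap_apply (k t : ℕ) (w : Signal m p) : windowMap k t w = window k w t := rfl

theorem window_shift (k s t : ℕ) (w : Signal m p) :
    window k (shift s w) t = window k w (t + s) := by
  funext r
  simp only [window, shift]
  congr 1
  omega

theorem window_shift_zero (k s : ℕ) (w : Signal m p) :
    window k (shift s w) 0 = window k w s := by
  rw [window_shift, zero_add]

theorem window_add (k t : ℕ) (w w' : Signal m p) :
    window k (w + w') t = window k w t + window k w' t := rfl

theorem window_sub (k t : ℕ) (w w' : Signal m p) :
    window k (w - w') t = window k w t - window k w' t := rfl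

theorem window_eq_iff {k : ℕ} {w w' : Signal m p} {t t' : ℕ} :
    window k w t = window k w' t' ↔ ∀ j < k, w (t + j) = w' (t' + j) := by
  constructor
  · intro h j hj
    funext v
    exact congrFun h (⟨j, hj⟩, v)
  · intro h
    funext r
    exact congrFun (h r.1 r.1.2) r.2

theorem window_eq_zero_iff {k : ℕ} {w : Signal m p} {t : ℕ} :
    window k w t = 0 ↔ ∀ j < k, w (t + j) = 0 := by
  have : (0 : Fin k × Var m p → ℝ) = window k 0 t := rfl
  rw [this, window_eq_iff]
  rfl

/-- A signal with a prescribed initial window. -/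
def extendZero (k : ℕ) (v : Fin k × Var m p → ℝ) : Signal m p :=
  fun t a => if h : t < k then v (⟨t, h⟩, a) else 0

@[simp] theorem window_extendZero (k : ℕ) (v : Fin k × Var m p → ℝ) :
    window k (extendZero k v) 0 = v := by
  funext r
  simp [window, extendZero]

/-! ### State-space behaviors as shift-invariant subspaces -/

namespace StateSpace

theorem isTrajectory_zero (S : StateSpace m p n) : S.IsTrajectory 0 0 := fun t => by
  have h : (fun i : Fin m => (0 : Signal m p) t (Sum.inl i)) = 0 := rfl
  have h' : (fun i : Fin p => (0 : Signal m p) t (Sum.inr i)) = 0 := rfl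
  rw [h, h']
  simp

theorem IsTrajectory.add {S : StateSpace m p n} {x x' : ℕ → Fin n → ℝ} {w w' : Signal m p}
    (hx : S.IsTrajectory x w) (hx' : S.IsTrajectory x' w') : S.IsTrajectory (x + x') (w + w') := by
  intro t
  have h : (fun i : Fin m => (w + w') t (Sum.inl i)) =
    (fun i : Fin m => w t (Sum.inl i)) + fun i => w' t (Sum.inl i) := rfl
  have h' : (fun i : Fin p => (w + w') t (Sum.inr i)) =
    (fun i : Fin p => w t (Sum.inr i)) + fun i => w' t (Sum.inr i) := rfl
  rw [h, h', (hx t).2, (hx' t).2]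
  simp only [Pi.add_apply, (hx t).1, (hx' t).1, mulVec_add]
  constructor <;> abel

theorem IsTrajectory.smul {S : StateSpace m p n} {x : ℕ → Fin n → ℝ} {w : Signal m p}
    (hx : S.IsTrajectory x w) (c : ℝ) : S.IsTrajectory (c • x) (c • w) := by
  intro t
  have h : (fun i : Fin m => (c • w) t (Sum.inl i)) = c • (fun i : Fin m => w t (Sum.inl i)) := rfl
  have h' : (fun i : Fin p => (c • w) t (Sum.inr i)) = c • (fun i : Fin p => w t (Sum.inr i)) := rfl
  rw [h, h', (hx t).2]
  simp only [Pi.smul_apply, (hx t).1, mulVec_smul, smul_add, and_self]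

/-- The behavior as a subspace of the space of signals. -/
def behaviorSubmodule (S : StateSpace m p n) : Submodule ℝ (Signal m p) where
  carrier := S.behavior
  zero_mem' := ⟨0, S.isTrajectory_zero⟩
  add_mem' := fun ⟨_, hx⟩ ⟨_, hx'⟩ => ⟨_, hx.add hx'⟩
  smul_mem' := fun c _ ⟨_, hx⟩ => ⟨_, hx.smul c⟩

theorem shift_mem (S : StateSpace m p n) {w : Signal m p} (hw : w ∈ S.behavior) (s : ℕ) :
    shift s w ∈ S.behavior := by
  obtain ⟨x, hx⟩ := hw
  refine ⟨fun t => x (t + s), fun t => ?_⟩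
  have := hx (t + s)
  rw [add_right_comm] at this
  exact this

/-- The state trajectory from an initial state and an input signal. -/
def stateSeq (S : StateSpace m p n) (x₀ : Fin n → ℝ) (u : ℕ → Fin m → ℝ) : ℕ → Fin n → ℝ
  | 0 => x₀
  | t + 1 => S.A *ᵥ S.stateSeq x₀ u t + S.B *ᵥ u t

/-- The external signal from an initial state and an input signal. -/
def response (S : StateSpace m p n) (x₀ : Fin n → ℝ) (u : ℕ → Fin m → ℝ) : Signal m p :=
  fun t => Sum.elim (u t) (S.C *ᵥ S.stateSeq x₀ u t + S.D *ᵥ u t)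

theorem isTrajectory_response (S : StateSpace m p n) (x₀ : Fin n → ℝ) (u : ℕ → Fin m → ℝ) :
    S.IsTrajectory (S.stateSeq x₀ u) (S.response x₀ u) :=
  fun _ => ⟨rfl, rfl⟩

theorem response_mem (S : StateSpace m p n) (x₀ : Fin n → ℝ) (u : ℕ → Fin m → ℝ) :
    S.response x₀ u ∈ S.behavior :=
  ⟨_, S.isTrajectory_response x₀ u⟩

/-- Trajectories with equal initial states and equal inputs before and at time `t` agree at `t`. -/
theorem IsTrajectory.eq_of_inputs_eq {S : StateSpace m p n} {x x' : ℕ → Fin n → ℝ}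
    {w w' : Signal m p} (hx : S.IsTrajectory x w) (hx' : S.IsTrajectory x' w') (h0 : x 0 = x' 0)
    {t : ℕ} (hu : ∀ s ≤ t, ∀ i, w s (Sum.inl i) = w' s (Sum.inl i)) : w t = w' t := by
  have hxs : ∀ s ≤ t, x s = x' s := by
    intro s
    induction s with
    | zero => exact fun _ => h0
    | succ s ih =>
      intro hs
      rw [(hx s).1, (hx' s).1, ih (by omega), funext (hu s (by omega))]
  funext v
  rcases v with i | i
  · exact hu t le_rfl i
  · have := congrFun (hx t).2 i
    have := congrFun (hx' t).2 i
    simp_all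

/-! ### Observability kernels, lag and determination by windows -/

theorem mem_ker_observability (S : StateSpace m p n) (k : ℕ) (x : Fin n → ℝ) :
    S.observability k *ᵥ x = 0 ↔ ∀ j < k, (S.C * S.A ^ j) *ᵥ x = 0 := by
  constructor
  · intro h j hj
    funext i
    exact congrFun h (⟨j, hj⟩, i)
  · intro h
    funext r
    exact congrFun (h r.1 r.1.2) r.2

theorem rank_observability_eq_iff (S : StateSpace m p n) (k : ℕ) :
    (S.observability k).rank = (S.observability (k + 1)).rank ↔
      ∀ x, S.observability k *ᵥ x = 0 → S.observability (k + 1) *ᵥ x = 0 := by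
  have hle : LinearMap.ker (S.observability (k + 1)).mulVecLin ≤
      LinearMap.ker (S.observability k).mulVecLin := by
    intro x hx
    simp only [LinearMap.mem_ker, mulVecLin_apply, mem_ker_observability] at hx ⊢
    exact fun j hj => hx j (by omega)
  have h1 := LinearMap.finrank_range_add_finrank_ker (S.observability k).mulVecLin
  have h2 := LinearMap.finrank_range_add_finrank_ker (S.observability (k + 1)).mulVecLin
  constructor
  · intro h x hx
    simp only [Matrix.rank] at h
    have := Submodule.eq_of_le_of_finrank_eq hle (by omega)
    have hx' : x ∈ LinearMap.ker (S.observability k).mulVecLin := hx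
    rw [← this] at hx'
    exact hx'
  · intro h
    have : LinearMap.ker (S.observability k).mulVecLin =
        LinearMap.ker (S.observability (k + 1)).mulVecLin := le_antisymm h hle
    simp only [Matrix.rank]
    rw [← this] at h2
    omega

/-- The ranks are nondecreasing and bounded by n, so they cannot grow strictly n+1 times. Thus the
infimum that defines the lag is attained and is not the default value of an empty set. -/
theorem rank_observability_lag (S : StateSpace m p n) :
    (S.observability S.lag).rank = (S.observability (S.lag + 1)).rank := by
  refine Nat.sInf_mem (s := {k : ℕ | (S.observability k).rank = (S.observability (k + 1)).rank}) ?_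
  by_contra hne
  rw [Set.not_nonempty_iff_eq_empty] at hne
  have hmono : ∀ k, (S.observability k).rank < (S.observability (k + 1)).rank := by
    intro k
    refine lt_of_le_of_ne ?_ (fun h => (hne ▸ h : k ∈ (∅ : Set ℕ)))
    have h1 := LinearMap.finrank_range_add_finrank_ker (S.observability k).mulVecLin
    have h2 := LinearMap.finrank_range_add_finrank_ker (S.observability (k + 1)).mulVecLin
    have hle : LinearMap.ker (S.observability (k + 1)).mulVecLin ≤
        LinearMap.ker (S.observability k).mulVecLin := by
      intro x hx
      simp only [LinearMap.mem_ker, mulVecLin_apply, mem_ker_observability] at hx ⊢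
      exact fun j hj => hx j (by omega)
    have h3 := Submodule.finrank_mono hle
    simp only [Matrix.rank]
    omega
  have hge : ∀ k, k ≤ (S.observability k).rank := by
    intro k
    induction k with
    | zero => exact Nat.zero_le _
    | succ k ih => exact lt_of_le_of_lt ih (hmono k)
  have h1 := hge (n + 1)
  have h2 := Matrix.rank_le_card_width (S.observability (n + 1))
  rw [Fintype.card_fin] at h2
  omega

/-- Once the kernels stop shrinking they stay constant: if x is unobservable over d+1 steps, then A
x is so over d steps, and the induction hypothesis applies to A x. -/
theorem observability_ker_of_lag_le (S : StateSpace m p n) {d : ℕ} (hd : S.lag ≤ d)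
    (x : Fin n → ℝ) (hx : S.observability d *ᵥ x = 0) : S.observability (d + 1) *ᵥ x = 0 := by
  induction d, hd using Nat.le_induction generalizing x with
  | base => exact (S.rank_observability_eq_iff _).1 S.rank_observability_lag x hx
  | succ d _ ih =>
    have hA := ih (S.A *ᵥ x) (by
      rw [mem_ker_observability] at hx ⊢
      intro j hj
      rw [mulVec_mulVec, Matrix.mul_assoc, ← pow_succ]
      exact hx (j + 1) (by omega))
    rw [mem_ker_observability] at hx hA ⊢
    intro j hj
    rcases j with _ | j
    · exact hx 0 (by omega)
    · have := hA j (by omega)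
      rwa [mulVec_mulVec, Matrix.mul_assoc, ← pow_succ] at this

theorem lag_le_of_ker (S : StateSpace m p n) {d : ℕ}
    (h : ∀ x, S.observability d *ᵥ x = 0 → S.observability (d + 1) *ᵥ x = 0) : S.lag ≤ d :=
  Nat.sInf_le ((S.rank_observability_eq_iff d).2 h)

theorem IsTrajectory.eq_pow_mulVec {S : StateSpace m p n} {x : ℕ → Fin n → ℝ} {w : Signal m p}
    (hx : S.IsTrajectory x w) {t : ℕ} (hu : ∀ s < t, ∀ i, w s (Sum.inl i) = 0) :
    x t = (S.A ^ t) *ᵥ x 0 := by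
  induction t with
  | zero => simp
  | succ t ih =>
    have : (fun i => w t (Sum.inl i)) = (0 : Fin m → ℝ) := funext (hu t (by omega))
    rw [(hx t).1, ih (fun s hs => hu s (by omega)), this, pow_succ', ← Matrix.mulVec_mulVec]
    simp

/-- A signal of the behavior that vanishes up to the lag stays zero as long as its input does. -/
theorem eq_zero_of_lag_le (S : StateSpace m p n) {d : ℕ} (hd : S.lag ≤ d) {w : Signal m p}
    (hw : w ∈ S.behavior) (h0 : ∀ t < d, w t = 0) (hu : ∀ i, w d (Sum.inl i) = 0) : w d = 0 := by
  obtain ⟨x, hx⟩ := hw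
  have hu' : ∀ s ≤ d, ∀ i, w s (Sum.inl i) = 0 := by
    intro s hs i
    rcases hs.lt_or_eq with h | rfl
    · rw [h0 s h]; rfl
    · exact hu i
  have hout : ∀ s ≤ d, (fun i => w s (Sum.inr i)) = (S.C * S.A ^ s) *ᵥ x 0 := by
    intro s hs
    have : (fun i => w s (Sum.inl i)) = (0 : Fin m → ℝ) := funext (hu' s hs)
    rw [(hx s).2, hx.eq_pow_mulVec (fun r hr => hu' r (by omega)), this, mulVec_mulVec]
    simp
  have hk := S.observability_ker_of_lag_le hd (x 0) (by
    rw [mem_ker_observability]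
    intro j hj
    rw [← hout j hj.le, h0 j hj]
    rfl)
  rw [mem_ker_observability] at hk
  funext v
  rcases v with i | i
  · exact hu i
  · have := congrFun (hout d le_rfl) i
    rw [hk d (by omega)] at this
    exact this

theorem eq_zero_of_input_eq_zero (S : StateSpace m p n) {d : ℕ} (hd : S.lag ≤ d) {w : Signal m p}
    (hw : w ∈ S.behavior) (h0 : ∀ t < d, w t = 0) (hu : ∀ t i, w t (Sum.inl i) = 0) : w = 0 := by
  funext t
  induction t using Nat.strong_induction_on with
  | _ t ih =>
    rcases lt_or_ge t d with h | h
    · exact h0 t h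
    · exact S.eq_zero_of_lag_le (hd.trans h) hw ih (hu t)

/-- A behavior is determined by its windows of any length that exceeds the lag. -/
theorem mem_of_windows (S : StateSpace m p n) {d : ℕ} (hd : S.lag ≤ d) {w : Signal m p}
    (hw : ∀ t, ∃ w' ∈ S.behavior, window (d + 1) w' 0 = window (d + 1) w t) : w ∈ S.behavior := by
  obtain ⟨w₀, ⟨x, hx⟩, h0⟩ := hw 0
  rw [window_eq_iff] at h0
  simp only [zero_add] at h0
  -- The candidate trajectory starts in the state of the first window and is driven by the input of
  -- w. Each further window forces its next output to agree with that of w, since signals that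
  -- vanish on d samples and have input zero at the next one vanish there too.
  set v := S.response (x 0) (fun t i => w t (Sum.inl i)) with hv
  have hvmem : v ∈ S.behavior := S.response_mem _ _
  suffices w = v by rwa [this]
  have key : ∀ t, ∀ s ≤ d + t, v s = w s := by
    intro t
    induction t with
    | zero =>
      intro s hs
      rw [← h0 s (by omega)]
      exact (S.isTrajectory_response (x 0) _).eq_of_inputs_eq hx rfl
        (fun r hr i => by rw [h0 r (by omega)]; rfl)
    | succ t ih =>
      intro s hs
      rcases (show s ≤ d + t ∨ s = d + t + 1 by omega) with h | rfl
      · exact ih s h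
      obtain ⟨w', hw', h'⟩ := hw (t + 1)
      rw [window_eq_iff] at h'
      simp only [zero_add] at h'
      have hδ := S.behaviorSubmodule.sub_mem (S.shift_mem hvmem (t + 1)) hw'
      have := S.eq_zero_of_lag_le hd hδ (fun r hr => by
        rw [Pi.sub_apply, h' r (by omega), shift, add_comm, ih _ (by omega), sub_self])
        (fun i => by
          simp only [Pi.sub_apply, h' d (by omega), shift, add_comm (t + 1) d]
          exact sub_self _)
      rw [Pi.sub_apply, sub_eq_zero, h' d (by omega), shift] at this
      rw [show d + t + 1 = d + (t + 1) by omega, this, add_comm]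
  funext t
  exact (key t t (by omega)).symm

/-- A controllable behavior has no proper sub-behavior with the same inputs. -/
theorem behavior_eq_of_subset {n' : ℕ} (S : StateSpace m p n) (S' : StateSpace m p n')
    (h : S'.behavior ⊆ S.behavior) (hc : Controllable S.behavior) : S'.behavior = S.behavior := by
  refine h.antisymm fun w₂ hw₂ => ?_
  -- Steer from the zero signal to w₂. The smaller system, started at state zero with the same
  -- input, produces a signal that agrees with w up to the lag, hence forever. So w, and with it the
  -- tail w₂, lies in the smaller behavior.
  obtain ⟨w, hw, t₂, -, h1, h2⟩ := hc 0 S.behaviorSubmodule.zero_mem w₂ hw₂ S.lag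
  set v := S'.response 0 (fun t i => w t (Sum.inl i)) with hv
  have hvmem : v ∈ S'.behavior := S'.response_mem _ _
  have hv0 : ∀ t ≤ S.lag, v t = 0 := by
    intro t ht
    refine (S'.isTrajectory_response 0 _).eq_of_inputs_eq S'.isTrajectory_zero rfl (fun s hs i => ?_)
    change w s (Sum.inl i) = 0
    rw [h1 s (hs.trans ht)]
    rfl
  have hz := S.eq_zero_of_input_eq_zero le_rfl (S.behaviorSubmodule.sub_mem hw (h hvmem))
    (fun t ht => by rw [Pi.sub_apply, h1 t ht.le, hv0 t ht.le]; simp)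
    (fun t i => by simp [hv, response])
  rw [sub_eq_zero] at hz
  have : w₂ = shift t₂ w := by
    funext t
    rw [shift, h2 _ (by omega), Nat.add_sub_cancel]
  rw [this, hz]
  exact S'.shift_mem hvmem t₂

/-- The space of windows of length `k` of the behavior. -/
def windowSpace (S : StateSpace m p n) (k : ℕ) : Submodule ℝ (Fin k × Var m p → ℝ) :=
  S.behaviorSubmodule.map (windowMap k 0)

theorem mem_windowSpace (S : StateSpace m p n) (k : ℕ) (v : Fin k × Var m p → ℝ) :
    v ∈ S.windowSpace k ↔ ∃ w ∈ S.behavior, window k w 0 = v := Iff.rfl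

/-- The trajectories `(x, w)` of the system. -/
def trajectorySubmodule (S : StateSpace m p n) :
    Submodule ℝ ((ℕ → Fin n → ℝ) × Signal m p) where
  carrier := {z | S.IsTrajectory z.1 z.2}
  zero_mem' := S.isTrajectory_zero
  add_mem' := fun hx hx' => IsTrajectory.add hx hx'
  smul_mem' := fun c _ hx => IsTrajectory.smul hx c

end StateSpace

/-- A linear map that vanishes on the kernel of another one factors through it. -/
theorem exists_comp_eq_of_ker_le {V X Y : Type*} [AddCommGroup V] [Module ℝ V] [AddCommGroup X]
    [Module ℝ X] [AddCommGroup Y] [Module ℝ Y] (f : V →ₗ[ℝ] X) (g : V →ₗ[ℝ] Y)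
    (h : LinearMap.ker f ≤ LinearMap.ker g) : ∃ e : X →ₗ[ℝ] Y, e ∘ₗ f = g := by
  obtain ⟨l, hl⟩ := ((LinearMap.ker f).liftQ f le_rfl).exists_leftInverse_of_injective
    (Submodule.ker_liftQ_eq_bot _ _ _ le_rfl)
  refine ⟨(LinearMap.ker f).liftQ g h ∘ₗ l, LinearMap.ext fun v => ?_⟩
  have := LinearMap.congr_fun hl ((LinearMap.ker f).mkQ v)
  simp only [LinearMap.comp_apply, Submodule.mkQ_apply, Submodule.liftQ_apply,
    LinearMap.id_apply] at this ⊢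
  rw [this, Submodule.liftQ_apply]

namespace StateSpace

/-- A window is a linear image of the initial state and the first k inputs. -/
theorem finrank_windowSpace_le (S : StateSpace m p n) (k : ℕ) :
    Module.finrank ℝ (S.windowSpace k) ≤ n + m * k := by
  let f : S.trajectorySubmodule →ₗ[ℝ] (Fin n → ℝ) × (Fin m × Fin k → ℝ) :=
    { toFun := fun z => (z.1.1 0, fun r => z.1.2 r.2 (Sum.inl r.1))
      map_add' := fun _ _ => rfl
      map_smul' := fun _ _ => rfl }
  let g : S.trajectorySubmodule →ₗ[ℝ] (Fin k × Var m p → ℝ) :=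
    windowMap k 0 ∘ₗ LinearMap.snd ℝ _ _ ∘ₗ S.trajectorySubmodule.subtype
  obtain ⟨e, he⟩ := exists_comp_eq_of_ker_le f g (by
    rintro ⟨⟨x, w⟩, hx⟩ hz
    have hz' : (x 0, fun r : Fin m × Fin k => w r.2 (Sum.inl r.1)) = 0 := hz
    rw [Prod.mk_eq_zero] at hz'
    change window k w 0 = 0
    rw [window_eq_zero_iff]
    intro j hj
    rw [zero_add]
    refine IsTrajectory.eq_of_inputs_eq (x' := 0) (w' := 0) hx
      S.trajectorySubmodule.zero_mem hz'.1 (fun s hs i => ?_)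
    exact congrFun hz'.2 (i, ⟨s, by omega⟩))
  have hle : S.windowSpace k ≤ LinearMap.range e := by
    rintro _ ⟨w, ⟨x, hx⟩, rfl⟩
    refine ⟨f ⟨(x, w), hx⟩, ?_⟩
    have := LinearMap.congr_fun he ⟨(x, w), hx⟩
    exact this
  refine (Submodule.finrank_mono hle).trans ((LinearMap.finrank_range_le e).trans ?_)
  simp

theorem window_mem_windowSpace (S : StateSpace m p n) {w : Signal m p} (hw : w ∈ S.behavior)
    (k t : ℕ) : window k w t ∈ S.windowSpace k :=
  ⟨shift t w, S.shift_mem hw t, window_shift_zero k t w⟩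

end StateSpace

/-! ### Quadratic difference forms and the data matrix inequality -/

theorem qdf_padEnd {N k : ℕ} (h : N ≤ k) (Ψ : Coeff m p N) (w : Signal m p) (t : ℕ) :
    qdf (padEnd k Ψ) w t = qdf Ψ w t := by
  obtain ⟨j, rfl⟩ := Nat.exists_eq_add_of_le h
  simp [qdf, dotProduct, mulVec, Fintype.sum_prod_type, Fin.sum_univ_add, padEnd, window]

theorem qdf_padStart {N : ℕ} (Ψ : Coeff m p N) (w : Signal m p) (t : ℕ) :
    qdf (padStart Ψ) w t = qdf Ψ w (t + 1) := by
  have h : ∀ (i : Fin N) (a : Var m p), window (N + 1) w t (i.succ, a) = window N w (t + 1) (i, a) := by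
    intro i a
    simp only [window, Fin.val_succ]
    congr 1
    omega
  simp [qdf, dotProduct, mulVec, Fintype.sum_prod_type, Fin.sum_univ_succ, padStart, h]

theorem qdf_add {N : ℕ} (Ψ Ψ' : Coeff m p N) (w : Signal m p) (t : ℕ) :
    qdf (Ψ + Ψ') w t = qdf Ψ w t + qdf Ψ' w t := by
  simp [qdf, add_mulVec]

theorem qdf_sub {N : ℕ} (Ψ Ψ' : Coeff m p N) (w : Signal m p) (t : ℕ) :
    qdf (Ψ - Ψ') w t = qdf Ψ w t - qdf Ψ' w t := by
  simp [qdf, sub_mulVec]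

theorem qdf_nonneg {N : ℕ} {Ψ : Coeff m p N} (h : Ψ.PosSemidef) (w : Signal m p) (t : ℕ) :
    0 ≤ qdf Ψ w t := by
  have := h.dotProduct_mulVec_nonneg (window N w t)
  rwa [star_trivial] at this

/-- The coefficient matrix of the slack `Q_Φ - Q_{∇Ψ}` of the dissipation inequality. -/
def slack {N d : ℕ} (Φ : Coeff m p N) (Ψ : Coeff m p d) : Coeff m p (d + 1) :=
  padEnd (d + 1) Ψ - padStart Ψ + padEnd (d + 1) Φ

theorem qdf_slack {N d : ℕ} (h : N ≤ d + 1) (Φ : Coeff m p N) (Ψ : Coeff m p d)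
    (w : Signal m p) (t : ℕ) :
    qdf (slack Φ Ψ) w t = qdf Ψ w t - qdf Ψ w (t + 1) + qdf Φ w t := by
  rw [slack, qdf_add, qdf_sub, qdf_padEnd (Nat.le_succ d), qdf_padStart, qdf_padEnd h]

theorem qdf_nabla_le_iff {N d : ℕ} (h : N ≤ d + 1) (Φ : Coeff m p N) (Ψ : Coeff m p d)
    (w : Signal m p) (t : ℕ) :
    qdf (nabla Ψ) w t ≤ qdf Φ w t ↔ 0 ≤ qdf (slack Φ Ψ) w t := by
  rw [qdf_slack h, nabla, qdf_sub, qdf_padEnd (Nat.le_succ d), qdf_padStart]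
  constructor <;> intro h <;> linarith

theorem isHermitian_padEnd {N : ℕ} (k : ℕ) {Ψ : Coeff m p N} (h : Ψ.IsHermitian) :
    (padEnd k Ψ).IsHermitian := by
  ext r s
  simp only [conjTranspose_apply, padEnd, of_apply, star_trivial]
  by_cases h1 : (r.1 : ℕ) < N ∧ (s.1 : ℕ) < N
  · rw [dif_pos h1, dif_pos h1.symm]
    simpa using h.apply (⟨r.1, h1.1⟩, r.2) (⟨s.1, h1.2⟩, s.2)
  · rw [dif_neg h1, dif_neg (fun h => h1 h.symm)]

theorem isHermitian_padStart {N : ℕ} {Ψ : Coeff m p N} (h : Ψ.IsHermitian) :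
    (padStart Ψ).IsHermitian := by
  ext ⟨i, a⟩ ⟨j, b⟩
  simp only [conjTranspose_apply, padStart, of_apply, star_trivial]
  refine Fin.cases ?_ (fun i => ?_) i <;> refine Fin.cases ?_ (fun j => ?_) j
  · rfl
  · rfl
  · rfl
  · simpa using h.apply (i, a) (j, b)

theorem isHermitian_slack {N d : ℕ} {Φ : Coeff m p N} {Ψ : Coeff m p d} (hΦ : Φ.IsHermitian)
    (hΨ : Ψ.IsHermitian) : (slack Φ Ψ).IsHermitian :=
  ((isHermitian_padEnd _ hΨ).sub (isHermitian_padStart hΨ)).add (isHermitian_padEnd _ hΦ)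

theorem dataLMI_iff {N d : ℕ} {κ : Type} [Fintype κ] (H : Matrix (Fin (d + 1) × Var m p) κ ℝ)
    {Φ : Coeff m p N} {Ψ : Coeff m p d} (hΦ : Φ.IsHermitian) (hΨ : Ψ.IsHermitian) :
    DataLMI H Φ Ψ ↔ ∀ x, 0 ≤ (H *ᵥ x) ⬝ᵥ (slack Φ Ψ *ᵥ (H *ᵥ x)) := by
  have key : ∀ x, star x ⬝ᵥ ((Hᵀ * slack Φ Ψ * H) *ᵥ x) =
      (H *ᵥ x) ⬝ᵥ (slack Φ Ψ *ᵥ (H *ᵥ x)) := by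
    intro x
    rw [star_trivial, Matrix.mul_assoc, ← mulVec_mulVec, dotProduct_mulVec, vecMul_transpose,
      mulVec_mulVec]
  have hherm : (Hᵀ * slack Φ Ψ * H).IsHermitian := by
    have := isHermitian_conjTranspose_mul_mul H (isHermitian_slack hΦ hΨ)
    rwa [conjTranspose_eq_transpose_of_trivial] at this
  change (Hᵀ * slack Φ Ψ * H).PosSemidef ↔ _
  rw [posSemidef_iff_dotProduct_mulVec]
  simp only [key, hherm, true_and]

/-! ### The Hankel matrix and the behaviors that explain the data -/

theorem hankel_col {T : ℕ} {data : Fin T → Var m p → ℝ} {w : Signal m p}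
    (hw : ∀ t : Fin T, data t = w t) {k : ℕ} (hk : k ≤ T) (c : Fin (T - k + 1)) :
    (hankel data k hk).col c = window k w c := by
  funext r
  simp only [hankel, col, transpose_apply, of_apply, window]
  rw [hw]
  simp only [add_comm]

theorem range_hankel_le {T : ℕ} {data : Fin T → Var m p → ℝ} (S : StateSpace m p n)
    (hw : data ∈ restrict T S.behavior) {k : ℕ} (hk : k ≤ T) :
    LinearMap.range (hankel data k hk).mulVecLin ≤ S.windowSpace k := by
  obtain ⟨w, hwS, hw⟩ := hw
  rw [range_mulVecLin, Submodule.span_le]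
  rintro _ ⟨c, rfl⟩
  rw [hankel_col hw]
  exact S.window_mem_windowSpace hwS k c

/-- A state-space system of least dimension among those that explain the data. -/
theorem exists_stateSpace_nMin {T : ℕ} {data : Fin T → Var m p → ℝ}
    (hne : (consistent data).Nonempty) :
    ∃ S : StateSpace m p (nMin data), data ∈ restrict T S.behavior := by
  obtain ⟨𝔅, h𝔅⟩ := hne
  obtain ⟨𝔅', ⟨hL, hd⟩, hn⟩ := Nat.sInf_mem (s := {n : ℕ | ∃ 𝔅 ∈ consistent data, stateDim 𝔅 = n})
    ⟨_, 𝔅, h𝔅, rfl⟩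
  obtain ⟨S, hS⟩ := Nat.sInf_mem (s := {n : ℕ | ∃ S : StateSpace m p n, S.behavior = 𝔅'}) hL
  rw [nMin, ← hn]
  exact ⟨S, hS.symm ▸ hd⟩

/-- Under the rank condition, the Hankel matrix determines each controllable behavior of bounded
lag that explains the data. -/
theorem range_hankel_eq_windowSpace {T : ℕ} {data : Fin T → Var m p → ℝ} {d : ℕ} (hT : d + 1 ≤ T)
    (hrank : (hankel data (d + 1) hT).rank = nMin data + m * (d + 1)) (S : StateSpace m p n)
    (hdata : data ∈ restrict T S.behavior) (hc : Controllable S.behavior) (hlag : S.lag ≤ d) :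
    LinearMap.range (hankel data (d + 1) hT).mulVecLin = S.windowSpace (d + 1) := by
  obtain ⟨S', hS'⟩ := exists_stateSpace_nMin ⟨_, ⟨n, S, rfl⟩, hdata⟩
  -- The Hankel columns are windows of S', and the rank condition makes their span as large as the
  -- window space of a system with `nMin data` states can be.
  have heq : LinearMap.range (hankel data (d + 1) hT).mulVecLin = S'.windowSpace (d + 1) := by
    refine Submodule.eq_of_le_of_finrank_le (range_hankel_le S' hS' hT) ?_
    refine (S'.finrank_windowSpace_le (d + 1)).trans ?_
    rw [← hrank, Matrix.rank]
  -- Windows of S' are combinations of data windows, hence windows of S; the lag bound lifts this to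
  -- whole signals.
  have hsub : S'.behavior ⊆ S.behavior := by
    intro w hw
    refine S.mem_of_windows hlag fun t => ?_
    have := S'.window_mem_windowSpace hw (d + 1) t
    rw [← heq] at this
    exact range_hankel_le S hdata hT this
  have := S.behavior_eq_of_subset S' hsub hc
  rw [heq]
  ext v
  rw [S.mem_windowSpace, S'.mem_windowSpace, this]

theorem dissipationIneq_of_dataLMI {T N d : ℕ} {data : Fin T → Var m p → ℝ} (hT : d + 1 ≤ T)
    (hrank : (hankel data (d + 1) hT).rank = nMin data + m * (d + 1)) {Φ : Coeff m p N}
    (hN : N ≤ d + 1) (hΦ : Φ.IsHermitian) {Ψ : Coeff m p d} (hΨ : Ψ.IsHermitian)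
    (hLMI : DataLMI (hankel data (d + 1) hT) Φ Ψ) (S : StateSpace m p n)
    (hdata : data ∈ restrict T S.behavior) (hc : Controllable S.behavior) (hlag : S.lag ≤ d) :
    DissipationIneq S.behavior Φ Ψ := by
  intro w hw t
  rw [qdf_nabla_le_iff hN]
  have hmem := S.window_mem_windowSpace hw (d + 1) t
  rw [← range_hankel_eq_windowSpace hT hrank S hdata hc hlag] at hmem
  obtain ⟨x, hx⟩ := hmem
  have := (dataLMI_iff _ hΦ hΨ).1 hLMI x
  rw [mulVecLin_apply] at hx
  rwa [hx] at this

theorem informative_iff {N T d L : ℕ} {Φ : Coeff m p N} (hd : (d : ℤ) = max (qdfDegree Φ) (L : ℤ))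
    (data : Fin T → Var m p → ℝ) :
    Informative L Φ data ↔ ∃ Ψ : Coeff m p d, Ψ.PosSemidef ∧
      ∀ 𝔅 ∈ consistent data ∩ LTIContLag m p L, DissipationIneq 𝔅 Φ Ψ := by
  obtain rfl : horizon Φ L = d := by rw [horizon, ← hd, Int.toNat_natCast]
  exact Iff.rfl

theorem informative_of_dataLMI {T N d L : ℕ} {data : Fin T → Var m p → ℝ} (hT : d + 1 ≤ T)
    (hrank : (hankel data (d + 1) hT).rank = nMin data + m * (d + 1)) {Φ : Coeff m p N}
    (hΦ : IsMinimalCoeff Φ) (hd : (d : ℤ) = max (qdfDegree Φ) (L : ℤ)) {Ψ : Coeff m p d}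
    (hΨ : Ψ.PosSemidef) (hLMI : DataLMI (hankel data (d + 1) hT) Φ Ψ) :
    (∀ 𝔅 ∈ consistent data ∩ LTIContLag m p L, DissipationIneq 𝔅 Φ Ψ) ∧ Informative L Φ data := by
  have h : ∀ 𝔅 ∈ consistent data ∩ LTIContLag m p L, DissipationIneq 𝔅 Φ Ψ := by
    rintro 𝔅 ⟨⟨-, hdata⟩, ⟨n, S, rfl⟩, hc, hlag⟩
    rw [lag_behavior] at hlag
    have h2 := hΦ.2
    exact dissipationIneq_of_dataLMI hT hrank (by omega) hΦ.1 hΨ.1 hLMI S hdata hc (by omega)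
  exact ⟨h, (informative_iff hd data).2 ⟨Ψ, hΨ, h⟩⟩

/-- No rank condition is needed in this direction: each vector H x is the initial window of some
signal of the behavior. -/
theorem dataLMI_of_dissipationIneq {T N d : ℕ} {data : Fin T → Var m p → ℝ} (hT : d + 1 ≤ T)
    {Φ : Coeff m p N} (hN : N ≤ d + 1) (hΦ : Φ.IsHermitian) {Ψ : Coeff m p d}
    (hΨ : Ψ.IsHermitian) (S : StateSpace m p n) (hdata : data ∈ restrict T S.behavior)
    (h : DissipationIneq S.behavior Φ Ψ) : DataLMI (hankel data (d + 1) hT) Φ Ψ := by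
  rw [dataLMI_iff _ hΦ hΨ]
  intro x
  obtain ⟨w, hw, hwx⟩ := range_hankel_le S hdata hT ⟨x, rfl⟩
  have := (qdf_nabla_le_iff hN Φ Ψ w 0).1 (h w hw 0)
  rw [windowMap_apply, mulVecLin_apply] at hwx
  rwa [qdf, hwx] at this

theorem nMin_le {T : ℕ} {data : Fin T → Var m p → ℝ} (S : StateSpace m p n)
    (hdata : data ∈ restrict T S.behavior) : nMin data ≤ n := by
  refine (Nat.sInf_le (s := {n : ℕ | ∃ 𝔅 ∈ consistent data, stateDim 𝔅 = n})
    ⟨S.behavior, ⟨⟨n, S, rfl⟩, hdata⟩, rfl⟩).trans ?_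
  exact Nat.sInf_le (s := {k : ℕ | ∃ S' : StateSpace m p k, S'.behavior = S.behavior}) ⟨S, rfl⟩

/-! ### Observable quotient and the lower bound for the window dimension -/

namespace StateSpace

/-- The unobservable states can be divided out without changing the behavior. -/
theorem exists_observable (S : StateSpace m p n) {d : ℕ} (hlag : S.lag ≤ d) :
    ∃ (r : ℕ) (S' : StateSpace m p r), S'.behavior = S.behavior ∧
      ∀ x, S'.observability d *ᵥ x = 0 → x = 0 := by
  set K := LinearMap.ker (S.observability d).mulVecLin with hK
  have hmem : ∀ x, x ∈ K ↔ ∀ j < d + 1, (S.C * S.A ^ j) *ᵥ x = 0 := by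
    intro x
    rw [← mem_ker_observability]
    refine ⟨S.observability_ker_of_lag_le hlag x, fun h => ?_⟩
    rw [mem_ker_observability] at h
    exact (S.mem_ker_observability d x).2 fun j hj => h j (by omega)
  have hmem' : ∀ x, x ∈ K ↔ ∀ j < d, (S.C * S.A ^ j) *ᵥ x = 0 := fun x =>
    S.mem_ker_observability d x
  let e := (Module.finBasis ℝ ((Fin n → ℝ) ⧸ K)).equivFun
  let π : (Fin n → ℝ) →ₗ[ℝ] (Fin (Module.finrank ℝ ((Fin n → ℝ) ⧸ K)) → ℝ) :=
    e.toLinearMap ∘ₗ K.mkQ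
  have hπ : LinearMap.ker π = K := by
    rw [LinearEquiv.ker_comp, Submodule.ker_mkQ]
  have hsurj : Function.Surjective π := e.surjective.comp K.mkQ_surjective
  obtain ⟨A', hA'⟩ := exists_comp_eq_of_ker_le π (π ∘ₗ S.A.mulVecLin) (by
    intro x hx
    rw [hπ, hmem] at hx
    rw [LinearMap.ker_comp, hπ, Submodule.mem_comap, hmem']
    intro j hj
    rw [mulVecLin_apply, mulVec_mulVec, Matrix.mul_assoc, ← pow_succ]
    exact hx (j + 1) (by omega))
  obtain ⟨C', hC'⟩ := exists_comp_eq_of_ker_le π S.C.mulVecLin (by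
    intro x hx
    rw [hπ, hmem] at hx
    simpa using hx 0 (by omega))
  have hA : ∀ x, A' (π x) = π (S.A *ᵥ x) := fun x => LinearMap.congr_fun hA' x
  have hC : ∀ x, C' (π x) = S.C *ᵥ x := fun x => LinearMap.congr_fun hC' x
  let S' : StateSpace m p _ :=
    ⟨LinearMap.toMatrix' A', LinearMap.toMatrix' (π ∘ₗ S.B.mulVecLin), LinearMap.toMatrix' C', S.D⟩
  have hSA : ∀ x, S'.A *ᵥ x = A' x := fun x => LinearMap.toMatrix'_mulVec A' x
  have hSB : ∀ u, S'.B *ᵥ u = π (S.B *ᵥ u) := fun u =>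
    LinearMap.toMatrix'_mulVec (π ∘ₗ S.B.mulVecLin) u
  have hSC : ∀ x, S'.C *ᵥ x = C' x := fun x => LinearMap.toMatrix'_mulVec C' x
  have htraj : ∀ x w, S.IsTrajectory x w → S'.IsTrajectory (fun t => π (x t)) w := by
    intro x w hx t
    rw [hSA, hSB, hSC, hA, hC, ← map_add, ← (hx t).1]
    exact ⟨rfl, (hx t).2⟩
  refine ⟨_, S', Set.Subset.antisymm ?_ ?_, ?_⟩
  · rintro w ⟨x', hx'⟩
    obtain ⟨x₀, hx₀⟩ := hsurj (x' 0)
    have h := S.isTrajectory_response x₀ (fun t i => w t (Sum.inl i))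
    have : w = S.response x₀ (fun t i => w t (Sum.inl i)) := by
      funext t
      exact hx'.eq_of_inputs_eq (htraj _ _ h) hx₀.symm (fun _ _ _ => rfl)
    rw [this]
    exact ⟨_, h⟩
  · rintro w ⟨x, hx⟩
    exact ⟨_, htraj x w hx⟩
  · intro x' hx'
    obtain ⟨x, rfl⟩ := hsurj x'
    have hpow : ∀ j, (S'.A ^ j) *ᵥ π x = π ((S.A ^ j) *ᵥ x) := by
      intro j
      induction j with
      | zero => simp
      | succ j ih => rw [pow_succ', ← mulVec_mulVec, ih, hSA, hA, mulVec_mulVec, ← pow_succ']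
    rw [← LinearMap.mem_ker, hπ, hmem']
    intro j hj
    have := (S'.mem_ker_observability d _).1 hx' j hj
    rwa [← mulVec_mulVec, hpow, hSC, hC, mulVec_mulVec] at this

/-- With k-step observability a window determines the initial state and the k inputs, and these are
free. -/
theorem le_finrank_windowSpace (S : StateSpace m p n) {k : ℕ}
    (hobs : ∀ x, S.observability k *ᵥ x = 0 → x = 0) :
    n + m * k ≤ Module.finrank ℝ (S.windowSpace k) := by
  let f : S.trajectorySubmodule →ₗ[ℝ] (Fin n → ℝ) × (Fin m × Fin k → ℝ) :=
    { toFun := fun z => (z.1.1 0, fun r => z.1.2 r.2 (Sum.inl r.1))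
      map_add' := fun _ _ => rfl
      map_smul' := fun _ _ => rfl }
  let g : S.trajectorySubmodule →ₗ[ℝ] S.windowSpace k :=
    { toFun := fun z => ⟨window k z.1.2 0, z.1.2, ⟨z.1.1, z.2⟩, rfl⟩
      map_add' := fun _ _ => rfl
      map_smul' := fun _ _ => rfl }
  have hf : Function.Surjective f := by
    rintro ⟨x₀, u⟩
    let u' : ℕ → Fin m → ℝ := fun t i => if h : t < k then u (i, ⟨t, h⟩) else 0
    refine ⟨⟨(S.stateSeq x₀ u', S.response x₀ u'), S.isTrajectory_response x₀ u'⟩, Prod.ext rfl (funext fun r => ?_)⟩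
    change u' r.2 r.1 = _
    simp [u']
  obtain ⟨e, he⟩ := exists_comp_eq_of_ker_le g f (by
    rintro ⟨⟨x, w⟩, hx⟩ hz
    have hz' : window k w 0 = 0 := congrArg Subtype.val hz
    rw [window_eq_zero_iff] at hz'
    simp only [zero_add] at hz'
    have hu : ∀ s < k, ∀ i, w s (Sum.inl i) = 0 := fun s hs i => by rw [hz' s hs]; rfl
    refine Prod.ext (hobs _ ?_) (funext fun r => hu r.2 r.2.2 r.1)
    rw [mem_ker_observability]
    intro j hj
    have h1 := (hx j).2
    have h2 : (fun i => w j (Sum.inl i)) = (0 : Fin m → ℝ) := funext (hu j hj)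
    have h3 : (fun i => w j (Sum.inr i)) = (0 : Fin p → ℝ) := by rw [hz' j hj]; rfl
    change (fun i => w j (Sum.inr i)) = S.C *ᵥ x j + _ at h1
    have h4 := IsTrajectory.eq_pow_mulVec hx (fun s hs => hu s (hs.trans hj))
    change x j = _ at h4
    rw [h3, h2, h4, mulVec_mulVec] at h1
    rw [mulVec_zero, add_zero] at h1
    exact h1.symm)
  have he' : Function.Surjective e := by
    intro z
    obtain ⟨y, rfl⟩ := hf z
    exact ⟨g y, LinearMap.congr_fun he y⟩
  have := LinearMap.finrank_le_finrank_of_surjective he'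
  simpa using this

end StateSpace

/-- The rank condition holds as soon as the data span the windows of a consistent behavior. -/
theorem rank_hankel_eq {T : ℕ} {data : Fin T → Var m p → ℝ} {d : ℕ} (hT : d + 1 ≤ T)
    (S : StateSpace m p n) (hdata : data ∈ restrict T S.behavior) (hlag : S.lag ≤ d)
    (h : S.windowSpace (d + 1) ≤ LinearMap.range (hankel data (d + 1) hT).mulVecLin) :
    (hankel data (d + 1) hT).rank = nMin data + m * (d + 1) := by
  apply le_antisymm
  · obtain ⟨S', hS'⟩ := exists_stateSpace_nMin ⟨_, ⟨n, S, rfl⟩, hdata⟩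
    rw [Matrix.rank]
    exact (Submodule.finrank_mono (range_hankel_le S' hS' hT)).trans (S'.finrank_windowSpace_le _)
  -- After removal of the unobservable states the window space has dimension at least r + m(d+1),
  -- and `nMin data ≤ r`.
  · obtain ⟨r, S', hS', hobs⟩ := S.exists_observable hlag
    have h1 := nMin_le S' (hS' ▸ hdata)
    have h2 := S'.le_finrank_windowSpace (k := d + 1) (fun x hx => hobs x (by
      rw [StateSpace.mem_ker_observability] at hx ⊢
      exact fun j hj => hx j (by omega)))
    have h3 : S'.windowSpace (d + 1) = S.windowSpace (d + 1) := by
      ext v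
      rw [S.mem_windowSpace, S'.mem_windowSpace, hS']
    have h4 := Submodule.finrank_mono h
    rw [h3] at h2
    rw [Matrix.rank]
    omega

/-! ### Kernel representations with monic output part -/

/-- The behavior of the difference equations `R w_{[t, t+L]} = 0`. -/
def kerBehavior (R : Matrix (Fin p) (Fin (L + 1) × Var m p) ℝ) : Submodule ℝ (Signal m p) where
  carrier := {w | ∀ t, R *ᵥ window (L + 1) w t = 0}
  zero_mem' := fun t => R.mulVec_zero
  add_mem' := fun {w w'} h h' t => by rw [window_add, mulVec_add, h t, h' t, add_zero]
  smul_mem' := fun c w h t => by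
    rw [← windowMap_apply, map_smul, mulVec_smul, windowMap_apply, h t, smul_zero]

/-- The leading coefficient of the output in the difference equations is the identity. -/
def IsMonic (R : Matrix (Fin p) (Fin (L + 1) × Var m p) ℝ) : Prop :=
  ∀ i j, R i (Fin.last L, Sum.inr j) = (1 : Matrix (Fin p) (Fin p) ℝ) i j

/-- The window that is zero except for the last output. -/
def lastOutput (L : ℕ) (y : Fin p → ℝ) : Fin (L + 1) × Var m p → ℝ :=
  fun r => if r.1 = Fin.last L then Sum.elim 0 y r.2 else 0

theorem IsMonic.mulVec_lastOutput {R : Matrix (Fin p) (Fin (L + 1) × Var m p) ℝ} (hR : IsMonic R)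
    (y : Fin p → ℝ) : R *ᵥ lastOutput L y = y := by
  funext i
  simp only [mulVec, dotProduct, Fintype.sum_prod_type, lastOutput, mul_ite, mul_zero]
  rw [Finset.sum_eq_single (Fin.last L) (fun b _ hb => by simp [hb]) (by simp)]
  simp [hR i, Matrix.one_apply]

theorem IsMonic.mulVec_sub_lastOutput {R : Matrix (Fin p) (Fin (L + 1) × Var m p) ℝ}
    (hR : IsMonic R) (v : Fin (L + 1) × Var m p → ℝ) :
    R *ᵥ (v - lastOutput L (R *ᵥ v)) = 0 := by
  rw [mulVec_sub, hR.mulVec_lastOutput, sub_self]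

/-- The window of length `L + 1` that follows `v` under the input zero. -/
def nextWindow (R : Matrix (Fin p) (Fin (L + 1) × Var m p) ℝ) (v : Fin (L + 1) × Var m p → ℝ) :
    Fin (L + 1) × Var m p → ℝ :=
  let b := window (L + 1) (extendZero (L + 1) v) 1
  b - lastOutput L (R *ᵥ b)

theorem nextWindow_apply (R : Matrix (Fin p) (Fin (L + 1) × Var m p) ℝ)
    (v : Fin (L + 1) × Var m p → ℝ) {k : ℕ} (hk : k < L) (a : Var m p) :
    nextWindow R v (⟨k, by omega⟩, a) = v (⟨k + 1, by omega⟩, a) := by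
  have h : (⟨k, by omega⟩ : Fin (L + 1)) ≠ Fin.last L := by
    rw [Ne, Fin.ext_iff]
    simp only [Fin.val_last]
    omega
  simp [nextWindow, lastOutput, h, window, extendZero, add_comm 1 k, hk]

/-- The equations can be solved for the newest output, so the window is continued step by step with
input zero. -/
theorem IsMonic.exists_mem_kerBehavior {R : Matrix (Fin p) (Fin (L + 1) × Var m p) ℝ}
    (hR : IsMonic R) {v : Fin (L + 1) × Var m p → ℝ} (hv : R *ᵥ v = 0) :
    ∃ w ∈ kerBehavior R, window (L + 1) w 0 = v := by
  let V : ℕ → Fin (L + 1) × Var m p → ℝ := fun t => (nextWindow R)^[t] v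
  have hsucc : ∀ t, V (t + 1) = nextWindow R (V t) := fun t =>
    Function.iterate_succ_apply' _ _ _
  let w : Signal m p := fun t a => V t (0, a)
  have hw : ∀ k (hk : k < L + 1) t a, w (t + k) a = V t (⟨k, hk⟩, a) := by
    intro k
    induction k with
    | zero => exact fun _ t a => rfl
    | succ k ih =>
      intro hk t a
      rw [show t + (k + 1) = t + 1 + k by omega, ih (by omega), hsucc,
        nextWindow_apply R _ (by omega)]
  have hwin : ∀ t, window (L + 1) w t = V t := fun t => funext fun r => hw r.1 r.1.2 t r.2
  refine ⟨w, fun t => ?_, hwin 0⟩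
  rw [hwin]
  cases t with
  | zero => exact hv
  | succ t =>
    rw [hsucc]
    exact hR.mulVec_sub_lastOutput _

/-- The equations have memory L: if the two signals share L samples at the junction, each window of
length L+1 of the concatenation is a window of one of them. -/
theorem concat_mem_kerBehavior {R : Matrix (Fin p) (Fin (L + 1) × Var m p) ℝ} {s : ℕ}
    {w₁ w₂ : Signal m p} (h₁ : ∀ t < s, R *ᵥ window (L + 1) w₁ t = 0) (h₂ : w₂ ∈ kerBehavior R)
    (h : window L w₁ s = window L w₂ 0) : concat s w₁ w₂ ∈ kerBehavior R := by
  rw [window_eq_iff] at h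
  simp only [zero_add] at h
  intro t
  rcases lt_or_ge t s with hts | hts
  · rw [← h₁ t hts]
    congr 1
    rw [window_eq_iff]
    intro j hj
    simp only [concat]
    split_ifs with hs
    · rfl
    · rw [← h (t + j - s) (by omega)]
      congr 1
      omega
  · rw [← h₂ (t - s)]
    congr 1
    rw [window_eq_iff]
    intro j hj
    simp only [concat]
    rw [if_neg (by omega)]
    congr 1
    omega

theorem window_concat (k s t : ℕ) (w₁ w₂ : Signal m p) :
    window k (concat s w₁ w₂) (s + t) = window k w₂ t := by
  rw [window_eq_iff]
  intro j hj
  simp only [concat]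
  rw [if_neg (by omega)]
  congr 1
  omega

theorem IsMonic.exists_extension {R : Matrix (Fin p) (Fin (L + 1) × Var m p) ℝ} (hR : IsMonic R)
    {w : Signal m p} {T : ℕ} (hT : L + 1 ≤ T)
    (hw : ∀ t, t + L < T → R *ᵥ window (L + 1) w t = 0) :
    ∃ w' ∈ kerBehavior R, ∀ t < T, w' t = w t := by
  obtain ⟨w₀, hw₀, h0⟩ := hR.exists_mem_kerBehavior (hw (T - L - 1) (by omega))
  have h0' := window_eq_iff.1 h0
  simp only [zero_add] at h0'
  refine ⟨concat (T - L - 1) w w₀, concat_mem_kerBehavior (fun t ht => hw t (by omega)) hw₀ ?_,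
    fun t ht => ?_⟩
  · rw [window_eq_iff]
    intro j hj
    rw [← h0' j (by omega), zero_add]
  · simp only [concat]
    split_ifs with hs
    · rfl
    · rw [h0' _ (by omega)]
      congr 1
      omega

theorem IsMonic.exists_window_eq {R : Matrix (Fin p) (Fin (L + 1) × Var m p) ℝ} (hR : IsMonic R)
    (z : Fin L × Var m p → ℝ) : ∃ w ∈ kerBehavior R, window L w 0 = z := by
  set v := window (L + 1) (extendZero L z) 0 with hv
  obtain ⟨w, hw, h⟩ := hR.exists_mem_kerBehavior (hR.mulVec_sub_lastOutput v)
  refine ⟨w, hw, ?_⟩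
  rw [← window_extendZero L z, window_eq_iff]
  intro j hj
  funext a
  have h1 := congrFun h (⟨j, by omega⟩, a)
  have h2 : (⟨j, by omega⟩ : Fin (L + 1)) ≠ Fin.last L := by
    rw [Ne, Fin.ext_iff]
    simp only [Fin.val_last]
    omega
  simpa [window, lastOutput, h2, hv] using h1

/-! ### State-space realization of monic kernel representations -/

theorem exists_stateSpace {X : Type*} [AddCommGroup X] [Module ℝ X] [FiniteDimensional ℝ X]
    (A : X →ₗ[ℝ] X) (B : (Fin m → ℝ) →ₗ[ℝ] X) (C : X →ₗ[ℝ] (Fin p → ℝ))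
    (D : (Fin m → ℝ) →ₗ[ℝ] (Fin p → ℝ)) :
    ∃ S : StateSpace m p (Module.finrank ℝ X), ∀ w, w ∈ S.behavior ↔
      ∃ x : ℕ → X, ∀ t, x (t + 1) = A (x t) + B (fun i => w t (Sum.inl i)) ∧
        (fun i => w t (Sum.inr i)) = C (x t) + D (fun i => w t (Sum.inl i)) := by
  let e := (Module.finBasis ℝ X).equivFun
  let S : StateSpace m p (Module.finrank ℝ X) :=
    ⟨LinearMap.toMatrix' (e.toLinearMap ∘ₗ A ∘ₗ e.symm.toLinearMap),
      LinearMap.toMatrix' (e.toLinearMap ∘ₗ B), LinearMap.toMatrix' (C ∘ₗ e.symm.toLinearMap),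
      LinearMap.toMatrix' D⟩
  have hA : ∀ x, S.A *ᵥ x = e (A (e.symm x)) := fun x => LinearMap.toMatrix'_mulVec _ x
  have hB : ∀ u, S.B *ᵥ u = e (B u) := fun u => LinearMap.toMatrix'_mulVec _ u
  have hC : ∀ x, S.C *ᵥ x = C (e.symm x) := fun x => LinearMap.toMatrix'_mulVec _ x
  have hD : ∀ u, S.D *ᵥ u = D u := fun u => LinearMap.toMatrix'_mulVec _ u
  refine ⟨S, fun w => ⟨?_, ?_⟩⟩
  · rintro ⟨x, hx⟩
    refine ⟨fun t => e.symm (x t), fun t => ?_⟩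
    obtain ⟨h1, h2⟩ := hx t
    rw [hA, hB, ← map_add] at h1
    rw [hC, hD] at h2
    exact ⟨(congrArg e.symm h1).trans (e.symm_apply_apply _), h2⟩
  · rintro ⟨x, hx⟩
    refine ⟨fun t => e (x t), fun t => ?_⟩
    rw [hA, hB, hC, hD, e.symm_apply_apply, ← map_add, ← (hx t).1]
    exact ⟨rfl, (hx t).2⟩

/-- The `k`-th coefficient of the difference operator of `R`. -/
def coeffMap (R : Matrix (Fin p) (Fin (L + 1) × Var m p) ℝ) (k : ℕ) :
    (Var m p → ℝ) →ₗ[ℝ] (Fin p → ℝ) :=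
  if h : k < L + 1 then Matrix.mulVecLin (Matrix.of fun i a => R i (⟨k, h⟩, a)) else 0

theorem mulVec_window (R : Matrix (Fin p) (Fin (L + 1) × Var m p) ℝ) (w : Signal m p) (t : ℕ) :
    R *ᵥ window (L + 1) w t = ∑ k ∈ Finset.range (L + 1), coeffMap R k (w (t + k)) := by
  rw [Finset.sum_range]
  funext i
  simp only [mulVec, dotProduct, Fintype.sum_prod_type, Finset.sum_apply]
  refine Finset.sum_congr rfl fun k _ => ?_
  rw [coeffMap, dif_pos k.2]
  simp [window, mulVec, dotProduct]

theorem IsMonic.coeffMap_last {R : Matrix (Fin p) (Fin (L + 1) × Var m p) ℝ} (hR : IsMonic R)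
    (s : Var m p → ℝ) :
    coeffMap R L s = (fun i => s (Sum.inr i)) + coeffMap R L (Sum.elim (fun i => s (Sum.inl i)) 0) := by
  funext i
  have h : (⟨L, Nat.lt_succ_self L⟩ : Fin (L + 1)) = Fin.last L := rfl
  simp [coeffMap, mulVec, dotProduct, h, hR i, Matrix.one_apply, add_comm]

/-- Observer form: Horner-type partial sums of the difference operator serve as states. Their
boundary value zero at index L is the equation R w = 0. -/
theorem kerBehavior_recursion {R : Matrix (Fin p) (Fin (L + 1) × Var m p) ℝ} {w : Signal m p} :
    w ∈ kerBehavior R ↔ ∃ x : ℕ → ℕ → Fin p → ℝ, (∀ t j, L ≤ j → x t j = 0) ∧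
      (∀ t j, j < L → x (t + 1) j = x t (j + 1) - coeffMap R (L - 1 - j) (w t)) ∧
      ∀ t, x t 0 = coeffMap R L (w t) := by
  constructor
  · intro hw
    refine ⟨fun t j => if j < L then
      ∑ i ∈ Finset.range (j + 1), coeffMap R (L - j + i) (w (t + i)) else 0,
      fun t j hj => if_neg (by omega), fun t j hj => ?_, fun t => ?_⟩
    -- For j + 1 = L the sum is the whole operator, so it equals the prescribed 0 by the difference
    -- equation.
    · have key : (if j + 1 < L then ∑ i ∈ Finset.range (j + 1 + 1),
          coeffMap R (L - (j + 1) + i) (w (t + i)) else 0) =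
          ∑ i ∈ Finset.range (j + 1 + 1), coeffMap R (L - (j + 1) + i) (w (t + i)) := by
        split_ifs with h
        · rfl
        · obtain rfl : L = j + 1 := by omega
          have := hw t
          rw [mulVec_window] at this
          rw [← this]
          refine Finset.sum_congr rfl fun i _ => ?_
          congr 2
          omega
      simp only [key, if_pos hj]
      rw [Finset.sum_range_succ' _ (j + 1), add_zero, add_zero,
        show L - (j + 1) = L - 1 - j by omega, add_sub_cancel_right]
      refine Finset.sum_congr rfl fun i _ => ?_
      rw [show L - j + i = L - 1 - j + (i + 1) by omega, show t + 1 + i = t + (i + 1) by omega]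
    · by_cases hL : 0 < L
      · simp [hL]
      · obtain rfl : L = 0 := by omega
        have := hw t
        rw [mulVec_window] at this
        simpa using this.symm
  · rintro ⟨x, hx, hx1, hx0⟩ t
    have key : ∀ j ≤ L, ∀ t, x (t + j) 0 =
        x t j - ∑ i ∈ Finset.range j, coeffMap R (L - j + i) (w (t + i)) := by
      intro j
      induction j with
      | zero => intro _ t; simp
      | succ j ih =>
        intro hj t
        rw [show t + (j + 1) = t + 1 + j by omega, ih (by omega) (t + 1), hx1 t j (by omega),
          Finset.sum_range_succ', add_zero, add_zero, show L - (j + 1) = L - 1 - j by omega,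
          sub_sub, add_comm (coeffMap R (L - 1 - j) (w t))]
        congr 2
        refine Finset.sum_congr rfl fun i _ => ?_
        rw [show L - j + i = L - 1 - j + (i + 1) by omega, show t + 1 + i = t + (i + 1) by omega]
    have := key L le_rfl t
    rw [hx t L le_rfl, hx0] at this
    rw [mulVec_window, Finset.sum_range_succ, this]
    simp

theorem IsMonic.exists_stateSpace {R : Matrix (Fin p) (Fin (L + 1) × Var m p) ℝ}
    (hR : IsMonic R) : ∃ (n : ℕ) (S : StateSpace m p n), S.behavior = kerBehavior R := by
  let get : ℕ → (Fin L → Fin p → ℝ) →ₗ[ℝ] (Fin p → ℝ) := fun j =>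
    if h : j < L then LinearMap.proj ⟨j, h⟩ else 0
  let inU : (Fin m → ℝ) →ₗ[ℝ] (Var m p → ℝ) :=
    { toFun := fun u => Sum.elim u 0
      map_add' := fun u u' => by funext a; rcases a with a | a <;> simp
      map_smul' := fun c u => by funext a; rcases a with a | a <;> simp }
  let inY : (Fin p → ℝ) →ₗ[ℝ] (Var m p → ℝ) :=
    { toFun := fun y => Sum.elim 0 y
      map_add' := fun u u' => by funext a; rcases a with a | a <;> simp
      map_smul' := fun c u => by funext a; rcases a with a | a <;> simp }
  -- Monicity turns x₀ = R_L w into y = x₀ - R_L (u, 0). Substituting this output into the recursion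
  -- for the other components gives A and B.
  let D : (Fin m → ℝ) →ₗ[ℝ] (Fin p → ℝ) := -(coeffMap R L ∘ₗ inU)
  let A : (Fin L → Fin p → ℝ) →ₗ[ℝ] (Fin L → Fin p → ℝ) :=
    LinearMap.pi fun j => get (j + 1) - coeffMap R (L - 1 - j) ∘ₗ inY ∘ₗ get 0
  let B : (Fin m → ℝ) →ₗ[ℝ] (Fin L → Fin p → ℝ) :=
    LinearMap.pi fun j => -(coeffMap R (L - 1 - j) ∘ₗ (inU + inY ∘ₗ D : (Fin m → ℝ) →ₗ[ℝ] _))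
  obtain ⟨S, hS⟩ := DataDissipativity.exists_stateSpace A B (get 0) D
  refine ⟨_, S, Set.ext fun w => ?_⟩
  rw [hS, SetLike.mem_coe, kerBehavior_recursion]
  have hsplit : ∀ t, w t = inU (fun i => w t (Sum.inl i)) + inY (fun i => w t (Sum.inr i)) := by
    intro t
    funext a
    rcases a with a | a <;> simp [inU, inY]
  have hout : ∀ t (y : Fin p → ℝ), y = coeffMap R L (w t) ↔
      (fun i => w t (Sum.inr i)) = y + D (fun i => w t (Sum.inl i)) := by
    intro t y
    rw [hR.coeffMap_last (w t)]
    change y = _ + coeffMap R L (inU fun i => w t (Sum.inl i)) ↔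
      _ = y + -(coeffMap R L (inU fun i => w t (Sum.inl i)))
    rw [← sub_eq_add_neg, eq_sub_iff_add_eq, eq_comm]
  have hstep : ∀ t (x : Fin L → Fin p → ℝ),
      (fun i => w t (Sum.inr i)) = get 0 x + D (fun i => w t (Sum.inl i)) → ∀ j : Fin L,
      (A x + B (fun i => w t (Sum.inl i))) j = get (j + 1) x - coeffMap R (L - 1 - j) (w t) := by
    intro t x hx j
    have hwt : coeffMap R (L - 1 - j) (w t) = coeffMap R (L - 1 - j)
        (inU (fun i => w t (Sum.inl i)) + inY (get 0 x + D fun i => w t (Sum.inl i))) := by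
      rw [← hx, ← hsplit]
    rw [hwt]
    simp only [A, B, Pi.add_apply, LinearMap.pi_apply, LinearMap.sub_apply, LinearMap.neg_apply,
      LinearMap.comp_apply, LinearMap.add_apply, map_add]
    abel
  constructor
  · rintro ⟨x, hx⟩
    refine ⟨fun t j => get j (x t), fun t j hj => ?_, fun t j hj => ?_, fun t => ?_⟩
    · simp only [get]
      rw [dif_neg (by omega)]
      rfl
    · have := hstep t (x t) (hx t).2 ⟨j, hj⟩
      rw [← (hx t).1] at this
      rw [← this]
      simp only [get]
      rw [dif_pos hj]
      rfl
    · exact (hout t _).2 (hx t).2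
  · rintro ⟨x, hx, hx1, hx0⟩
    have hget : ∀ t j, get j (fun k : Fin L => x t k) = x t j := by
      intro t j
      simp only [get]
      split_ifs with h
      · rfl
      · exact (hx t j (by omega)).symm
    have h2 : ∀ t, (fun i => w t (Sum.inr i)) =
        get 0 (fun k : Fin L => x t k) + D (fun i => w t (Sum.inl i)) := by
      intro t
      rw [hget]
      exact (hout t _).1 (hx0 t)
    refine ⟨fun t k => x t k, fun t => ⟨funext fun j => ?_, h2 t⟩⟩
    rw [hstep t _ (h2 t) j, hget]
    exact hx1 t j j.2

theorem StateSpace.lag_le_of_behavior (S : StateSpace m p n) {d : ℕ}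
    (h : ∀ w ∈ S.behavior, (∀ t i, w t (Sum.inl i) = 0) → (∀ t < d, w t = 0) → w d = 0) :
    S.lag ≤ d := by
  refine S.lag_le_of_ker fun x hx => ?_
  rw [mem_ker_observability] at hx ⊢
  have htr := S.isTrajectory_response x (fun _ => 0)
  have hout : ∀ j i, S.response x (fun _ => 0) j (Sum.inr i) = ((S.C * S.A ^ j) *ᵥ x) i := by
    intro j i
    have h1 := htr.eq_pow_mulVec (t := j) (fun _ _ _ => rfl)
    change S.stateSeq x (fun _ => 0) j = (S.A ^ j) *ᵥ x at h1
    simp [response, h1]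
  have := h _ (S.response_mem x fun _ => 0) (fun _ _ => rfl) (fun t ht => by
    funext a
    rcases a with a | a
    · rfl
    · rw [hout, hx t ht]; rfl)
  intro j hj
  rcases (show j < d ∨ j = d by omega) with hj | rfl
  · exact hx j hj
  · funext i
    rw [← hout, this]
    rfl

theorem IsMonic.lag_le {R : Matrix (Fin p) (Fin (L + 1) × Var m p) ℝ} (hR : IsMonic R)
    (S : StateSpace m p n) (hS : S.behavior = kerBehavior R) : S.lag ≤ L := by
  refine S.lag_le_of_behavior fun w hw hu h0 => ?_
  rw [hS] at hw
  have h1 := hw 0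
  have h2 : window (L + 1) w 0 = lastOutput L (fun i => w L (Sum.inr i)) := by
    funext r
    obtain ⟨k, a⟩ := r
    simp only [window, lastOutput, zero_add]
    split_ifs with h
    · subst h
      rcases a with a | a
      · exact hu L a
      · rfl
    · have hk : (k : ℕ) < L := Fin.val_lt_last h
      rw [h0 k hk]
      rfl
  rw [h2, hR.mulVec_lastOutput] at h1
  funext a
  rcases a with a | a
  · exact hu L a
  · exact congrFun h1 a

/-! ### Complex functionals on real vectors -/

/-- The pairing of a complex coefficient vector with a real vector. -/
noncomputable def cdot {ι : Type*} [Fintype ι] (f : ι → ℂ) (z : ι → ℝ) : ℂ := ∑ r, f r * z r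

section cdot

variable {ι : Type*} [Fintype ι]

theorem cdot_add (f : ι → ℂ) (z z' : ι → ℝ) : cdot f (z + z') = cdot f z + cdot f z' := by
  simp [cdot, mul_add, Finset.sum_add_distrib]

theorem cdot_sub (f : ι → ℂ) (z z' : ι → ℝ) : cdot f (z - z') = cdot f z - cdot f z' := by
  simp [cdot, mul_sub, Finset.sum_sub_distrib]

theorem cdot_smul (f : ι → ℂ) (c : ℝ) (z : ι → ℝ) : cdot f (c • z) = c * cdot f z := by
  simp [cdot, Finset.mul_sum, mul_left_comm]

@[simp] theorem cdot_zero (f : ι → ℂ) : cdot f 0 = 0 := by simp [cdot]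

theorem add_cdot (f f' : ι → ℂ) (z : ι → ℝ) : cdot (f + f') z = cdot f z + cdot f' z := by
  simp [cdot, add_mul, Finset.sum_add_distrib]

theorem sub_cdot (f f' : ι → ℂ) (z : ι → ℝ) : cdot (f - f') z = cdot f z - cdot f' z := by
  simp [cdot, sub_mul, Finset.sum_sub_distrib]

theorem smul_cdot (c : ℂ) (f : ι → ℂ) (z : ι → ℝ) : cdot (c • f) z = c * cdot f z := by
  simp [cdot, Finset.mul_sum, mul_assoc]

@[simp] theorem zero_cdot (z : ι → ℝ) : cdot (0 : ι → ℂ) z = 0 := by simp [cdot]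

theorem sum_cdot {κ : Type*} (s : Finset κ) (f : κ → ι → ℂ) (z : ι → ℝ) :
    cdot (∑ k ∈ s, f k) z = ∑ k ∈ s, cdot (f k) z := by
  simp only [cdot, Finset.sum_apply, Finset.sum_mul]
  exact Finset.sum_comm

/-- `cdot` as a real-linear map. -/
noncomputable def cdotMap (f : ι → ℂ) : (ι → ℝ) →ₗ[ℝ] ℂ where
  toFun := cdot f
  map_add' := cdot_add f
  map_smul' := fun c z => by simp [cdot_smul]

@[simp] theorem cdotMap_apply (f : ι → ℂ) (z : ι → ℝ) : cdotMap f z = cdot f z := rfl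

theorem cdot_single [DecidableEq ι] (f : ι → ℂ) (r : ι) : cdot f (Pi.single r 1) = f r := by
  rw [cdot, Finset.sum_eq_single r (fun b _ hb => by simp [hb]) (by simp)]
  simp

theorem cdot_linearMap [DecidableEq ι] (g : (ι → ℝ) →ₗ[ℝ] ℂ) (z : ι → ℝ) :
    cdot (fun r => g (Pi.single r 1)) z = g z := by
  rw [← cdotMap_apply]
  congr 1
  refine LinearMap.pi_ext' fun r => LinearMap.ext_ring ?_
  simp [cdot_single]

theorem eq_zero_of_cdot_eq_zero {f : ι → ℂ} (h : ∀ z, cdot f z = 0) : f = 0 := by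
  classical
  funext r
  rw [← cdot_single f r, h]
  rfl

end cdot

/-! ### A spectral criterion for controllability -/

/-- The windows of length `L` at time `N` that can be reached from the zero window. -/
def reachable (R : Matrix (Fin p) (Fin (L + 1) × Var m p) ℝ) (N : ℕ) :
    Submodule ℝ (Fin L × Var m p → ℝ) :=
  (kerBehavior R ⊓ LinearMap.ker (windowMap L 0)).map (windowMap L N)

theorem mem_reachable {R : Matrix (Fin p) (Fin (L + 1) × Var m p) ℝ} {N : ℕ}
    {z : Fin L × Var m p → ℝ} :
    z ∈ reachable R N ↔ ∃ w ∈ kerBehavior R, window L w 0 = 0 ∧ window L w N = z := by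
  simp only [reachable, Submodule.mem_map, Submodule.mem_inf, LinearMap.mem_ker,
    windowMap_apply, and_assoc]

theorem window_zero_signal (k t : ℕ) : window k (0 : Signal m p) t = 0 := rfl

/-- A trajectory that starts from the zero window may be delayed by one step. -/
theorem reachable_succ_le (R : Matrix (Fin p) (Fin (L + 1) × Var m p) ℝ) (N : ℕ) :
    reachable R N ≤ reachable R (N + 1) := by
  intro z hz
  obtain ⟨w, hw, h0, h1⟩ := mem_reachable.1 hz
  refine mem_reachable.2 ⟨concat 1 0 w, concat_mem_kerBehavior (fun t _ => by
    rw [window_zero_signal, mulVec_zero]) hw (by rw [h0]; rfl), ?_, ?_⟩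
  · rw [window_eq_zero_iff] at h0 ⊢
    intro j hj
    simp only [concat, zero_add]
    split_ifs with hj1
    · rfl
    · have := h0 (j - 1) (by omega)
      rwa [zero_add] at this
  · rw [add_comm, window_concat, h1]

/-- Hautus test without a state-space form. The reachable spaces stabilize; if the limit is proper,
its complex annihilator is a nonzero space invariant under the transposed one-step map, and an
eigenvector there is a functional with an autonomous law. -/
theorem reachable_eq_top {R : Matrix (Fin p) (Fin (L + 1) × Var m p) ℝ} (hR : IsMonic R)
    (h : ∀ (μ : ℂ) (f : Fin L × Var m p → ℂ), (∀ w ∈ kerBehavior R,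
      cdot f (window L w 1) = μ * cdot f (window L w 0)) → f = 0) :
    ∃ N, reachable R N = ⊤ := by
  classical
  have hmono : Monotone (reachable R) := monotone_nat_of_le_succ (reachable_succ_le R)
  obtain ⟨N, hN⟩ := monotone_stabilizes_iff_noetherian.mpr
    (inferInstance : IsNoetherian ℝ (Fin L × Var m p → ℝ)) ⟨reachable R, hmono⟩
  have hle : ∀ k, reachable R k ≤ reachable R N := by
    intro k
    rcases le_total k N with hk | hk
    · exact hmono hk
    · exact (hN k hk).ge
  refine ⟨N, ?_⟩
  by_contra hne
  have hsurj : LinearMap.range ((windowMap L 0).domRestrict (kerBehavior R)) = ⊤ := by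
    rw [LinearMap.range_eq_top]
    intro z
    obtain ⟨w, hw, hz⟩ := hR.exists_window_eq z
    exact ⟨⟨w, hw⟩, hz⟩
  -- A linear choice of a continuation for each window of length L; A is the resulting one-step map,
  -- and T below is its transpose.
  obtain ⟨s, hs⟩ := LinearMap.exists_rightInverse_of_surjective _ hsurj
  let A : (Fin L × Var m p → ℝ) →ₗ[ℝ] (Fin L × Var m p → ℝ) :=
    (windowMap L 1).domRestrict (kerBehavior R) ∘ₗ s
  have hs0 : ∀ z, window L (s z : Signal m p) 0 = z := fun z => LinearMap.congr_fun hs z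
  have hs1 : ∀ z, window L (s z : Signal m p) 1 = A z := fun z => rfl
  have hA : ∀ z ∈ reachable R N, A z ∈ reachable R N := by
    intro z hz
    obtain ⟨w, hw, h0, h1⟩ := mem_reachable.1 hz
    have hzs : window L w N = window L (s z : Signal m p) 0 := by rw [h1, hs0]
    refine hle (N + 1) (mem_reachable.2 ⟨concat N w (s z),
      concat_mem_kerBehavior (fun t _ => hw t) (s z).2 hzs, ?_, ?_⟩)
    · rw [← h0, window_eq_iff]
      rw [window_eq_iff] at hzs
      intro j hj
      simp only [concat, zero_add]
      split_ifs with hjN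
      · rfl
      · have := hzs (j - N) (by omega)
        rw [zero_add] at this
        rw [← this]
        congr 1
        omega
    · rw [window_concat, hs1]
  let T : (Fin L × Var m p → ℂ) →ₗ[ℂ] (Fin L × Var m p → ℂ) :=
    { toFun := fun f r => cdot f (A (Pi.single r 1))
      map_add' := fun f f' => funext fun r => add_cdot _ _ _
      map_smul' := fun c f => funext fun r => smul_cdot _ _ _ }
  have hT : ∀ f z, cdot (T f) z = cdot f (A z) := fun f z =>
    cdot_linearMap (cdotMap f ∘ₗ A) z
  let E : Submodule ℂ (Fin L × Var m p → ℂ) :=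
    { carrier := {f | ∀ z ∈ reachable R N, cdot f z = 0}
      zero_mem' := fun z _ => zero_cdot z
      add_mem' := fun {f f'} hf hf' z hz => by rw [add_cdot, hf z hz, hf' z hz, add_zero]
      smul_mem' := fun c f hf z hz => by rw [smul_cdot, hf z hz, mul_zero] }
  have hTE : ∀ f ∈ E, T f ∈ E := fun f hf z hz => by rw [hT, hf _ (hA z hz)]
  obtain ⟨φ, hφ0, hφ⟩ := Submodule.exists_le_ker_of_lt_top _ (lt_top_iff_ne_top.2 hne)
  have : Nontrivial E := by
    let g : Fin L × Var m p → ℂ := fun r => (Complex.ofRealLI.toLinearMap ∘ₗ φ) (Pi.single r 1)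
    have hg : ∀ z, cdot g z = φ z := fun z => cdot_linearMap (Complex.ofRealLI.toLinearMap ∘ₗ φ) z
    refine ⟨⟨⟨g, fun z hz => ?_⟩, 0, fun h0 => hφ0 (LinearMap.ext fun z => ?_)⟩⟩
    · rw [hg, LinearMap.mem_ker.1 (hφ hz), Complex.ofReal_zero]
    · have h0' : g = 0 := congrArg Subtype.val h0
      have := hg z
      rw [h0', zero_cdot] at this
      exact_mod_cast this.symm
  obtain ⟨μ, hμ⟩ := Module.End.exists_eigenvalue (T.restrict hTE)
  obtain ⟨⟨f, hf⟩, hfμ, hf0⟩ := hμ.exists_hasEigenvector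
  have hTf : T f = μ • f := congrArg Subtype.val (Module.End.mem_eigenspace_iff.1 hfμ)
  refine hf0 (Subtype.ext (h μ f fun w hw => ?_))
  -- Two continuations of the same window differ after one step by a reachable window, which f
  -- annihilates; so the law holds for every continuation, not only the chosen one.
  have hmem : window L w 1 - A (window L w 0) ∈ reachable R N := by
    refine hle 1 (mem_reachable.2 ⟨w - s (window L w 0),
      (kerBehavior R).sub_mem hw (s _).2, ?_, ?_⟩)
    · rw [window_sub, hs0, sub_self]
    · rw [window_sub, hs1]
  have := hf _ hmem
  rw [cdot_sub, sub_eq_zero] at this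
  rw [this, ← hT, hTf, smul_cdot]

theorem IsMonic.controllable {R : Matrix (Fin p) (Fin (L + 1) × Var m p) ℝ} (hR : IsMonic R)
    (h : ∀ (μ : ℂ) (f : Fin L × Var m p → ℂ), (∀ w ∈ kerBehavior R,
      cdot f (window L w 1) = μ * cdot f (window L w 0)) → f = 0) :
    Controllable (kerBehavior R : Set (Signal m p)) := by
  obtain ⟨N, hN⟩ := reachable_eq_top hR h
  intro w₁ hw₁ w₂ hw₂ t₁
  -- A correction that starts at time t₁ + 1 leaves w₁ intact up to t₁ and, N steps later, moves its
  -- window onto the initial window of w₂.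
  have hz : window L w₂ 0 - window L w₁ (t₁ + 1 + N) ∈ reachable R N := hN ▸ Submodule.mem_top
  obtain ⟨δ, hδ, h0, h1⟩ := mem_reachable.1 hz
  have hδ' : concat (t₁ + 1) 0 δ ∈ kerBehavior R :=
    concat_mem_kerBehavior (fun t _ => by rw [window_zero_signal, mulVec_zero]) hδ (by rw [h0]; rfl)
  have h3 := (kerBehavior R).add_mem hw₁ hδ'
  refine ⟨concat (t₁ + 1 + N) (w₁ + concat (t₁ + 1) 0 δ) w₂,
    concat_mem_kerBehavior (fun t _ => h3 t) hw₂ ?_, t₁ + 1 + N, by omega, fun t ht => ?_,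
    fun t ht => ?_⟩
  · rw [window_add, window_concat, h1, add_sub_cancel]
  · simp only [concat, Pi.add_apply]
    rw [if_pos (by omega), if_pos (by omega)]
    exact add_zero _
  · simp only [concat]
    rw [if_neg (by omega)]

/-- A scalar signal `f(σ) w` on a controllable behavior cannot obey an autonomous law
`z(t+1) = μ z(t)` unless it is zero. -/
theorem cdot_window_eq_zero {𝔅 : Set (Signal m p)} (hc : Controllable 𝔅) (h0 : 0 ∈ 𝔅)
    (hs : ∀ w ∈ 𝔅, ∀ s, shift s w ∈ 𝔅) {μ : ℂ} {f : Fin L × Var m p → ℂ}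
    (hf : ∀ w ∈ 𝔅, cdot f (window L w 1) = μ * cdot f (window L w 0)) :
    ∀ w ∈ 𝔅, cdot f (window L w 0) = 0 := by
  intro w₂ hw₂
  -- Along a signal that leads from zero to w₂ the scalar starts at zero, and the autonomous law
  -- keeps it there.
  obtain ⟨w, hw, t₂, -, h1, h2⟩ := hc 0 h0 w₂ hw₂ L
  have hz : ∀ t, cdot f (window L w t) = 0 := by
    intro t
    induction t with
    | zero =>
      have : window L w 0 = 0 := window_eq_zero_iff.2 fun j hj => h1 _ (by omega)
      rw [this, cdot_zero]
    | succ t ih =>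
      have := hf _ (hs w hw t)
      rw [window_shift, window_shift, zero_add, ih, mul_zero, add_comm] at this
      exact this
  have : window L w₂ 0 = window L w t₂ := by
    rw [window_eq_iff]
    intro j hj
    rw [h2 _ (by omega)]
    congr 1
    omega
  rw [this, hz]

/-! ### Resonances of a functional on a controllable behavior -/

/-- The numbers `μ` for which `η(σ) w` is divisible by `σ - μ` on the behavior. -/
def resonances (S : StateSpace m p n) (η : (Fin (L + 1) × Var m p → ℝ) →ₗ[ℝ] ℝ) : Set ℂ :=
  {μ | ∃ f : Fin L × Var m p → ℂ, ∀ w ∈ S.behavior,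
    cdot f (window L w 1) - μ * cdot f (window L w 0) = (η (window (L + 1) w 0) : ℂ)}

/-- The vanishing moments extend to all polynomials by linearity; test with a Lagrange basis
polynomial. -/
theorem eq_zero_of_sum_mul_pow_eq_zero {ι : Type*} (s : Finset ι) {g lam : ι → ℂ}
    (hinj : Set.InjOn lam s) (h : ∀ j : ℕ, ∑ i ∈ s, g i * lam i ^ j = 0) : ∀ i ∈ s, g i = 0 := by
  classical
  intro i hi
  have hq : ∀ q : Polynomial ℂ, ∑ k ∈ s, g k * q.eval (lam k) = 0 := by
    intro q
    simp only [Polynomial.eval_eq_sum_range, Finset.mul_sum]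
    rw [Finset.sum_comm]
    refine Finset.sum_eq_zero fun j _ => ?_
    have := congrArg (fun z => q.coeff j * z) (h j)
    rw [mul_zero, Finset.mul_sum] at this
    rw [← this]
    exact Finset.sum_congr rfl fun k _ => by ring
  have := hq (Lagrange.basis s lam i)
  rw [Finset.sum_eq_single i] at this
  · rwa [Lagrange.eval_basis_self hinj hi, mul_one] at this
  · intro k hk hki
    rw [Lagrange.eval_basis_of_ne hki.symm hk, mul_zero]
  · exact fun h => (h hi).elim

/-- Functionals that witness distinct resonances are linearly independent in a finite-dimensional
space. Along a signal that starts at zero, a linear relation among them propagates to the relations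
with coefficients g_μ μ^j for all j, which force g = 0. -/
theorem finite_resonances (S : StateSpace m p n) (hc : Controllable S.behavior)
    (η : (Fin (L + 1) × Var m p → ℝ) →ₗ[ℝ] ℝ)
    (hη : ∃ w ∈ S.behavior, η (window (L + 1) w 0) ≠ 0) : (resonances S η).Finite := by
  classical
  obtain ⟨w₂, hw₂, hw₂0⟩ := hη
  obtain ⟨w₁, hw₁, t₂, -, h1, h2⟩ := hc 0 S.behaviorSubmodule.zero_mem w₂ hw₂ L
  have hex : ∃ t, η (window (L + 1) w₁ t) ≠ 0 := by
    refine ⟨t₂, ?_⟩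
    have : window (L + 1) w₁ t₂ = window (L + 1) w₂ 0 := by
      rw [window_eq_iff]
      intro j hj
      rw [h2 _ (by omega)]
      congr 1
      omega
    rwa [this]
  choose! f hf using fun μ (hμ : μ ∈ resonances S η) => hμ
  have hstep : ∀ μ ∈ resonances S η, ∀ w ∈ S.behavior, ∀ t, cdot (f μ) (window L w (t + 1)) =
      μ * cdot (f μ) (window L w t) + (η (window (L + 1) w t) : ℂ) := by
    intro μ hμ w hw t
    have := hf μ hμ _ (S.shift_mem hw t)
    rw [window_shift, window_shift_zero, window_shift_zero, add_comm 1 t] at this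
    rw [← this]
    ring
  -- Up to the first time k at which η is nonzero, all scalars f_μ(w₁) vanish; at k the common
  -- forcing term isolates the sum of g_μ μ^j.
  set k := Nat.find hex with hk
  have hkne : η (window (L + 1) w₁ k) ≠ 0 := Nat.find_spec hex
  have hz0 : ∀ μ ∈ resonances S η, ∀ t ≤ k, cdot (f μ) (window L w₁ t) = 0 := by
    intro μ hμ t
    induction t with
    | zero =>
      intro _
      have : window L w₁ 0 = 0 := window_eq_zero_iff.2 fun j hj => h1 _ (by omega)
      rw [this, cdot_zero]
    | succ t ih =>
      intro ht
      have : η (window (L + 1) w₁ t) = 0 := by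
        by_contra h
        exact Nat.find_min hex (show t < k by omega) h
      rw [hstep μ hμ w₁ hw₁, ih (by omega), this, mul_zero, Complex.ofReal_zero, add_zero]
  have hli : LinearIndependent ℂ (fun μ : resonances S η => f μ) := by
    rw [linearIndependent_iff']
    intro s g hg
    have key : ∀ j : ℕ, (∀ t, k ≤ t →
        ∑ μ ∈ s, g μ * (μ : ℂ) ^ j * cdot (f μ) (window L w₁ t) = 0) ∧
        ∑ μ ∈ s, g μ * (μ : ℂ) ^ j = 0 := by
      have hnext : ∀ j : ℕ, (∀ t, k ≤ t →
          ∑ μ ∈ s, g μ * (μ : ℂ) ^ j * cdot (f μ) (window L w₁ t) = 0) →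
          ∀ t, k ≤ t → ∑ μ ∈ s, g μ * (μ : ℂ) ^ (j + 1) * cdot (f μ) (window L w₁ t) +
            (∑ μ ∈ s, g μ * (μ : ℂ) ^ j) * (η (window (L + 1) w₁ t) : ℂ) = 0 := by
        intro j hj t ht
        rw [← hj (t + 1) (by omega), Finset.sum_mul, ← Finset.sum_add_distrib]
        refine Finset.sum_congr rfl fun μ _ => ?_
        rw [hstep μ μ.2 w₁ hw₁ t]
        ring
      have hsum : ∀ j : ℕ, (∀ t, k ≤ t →
          ∑ μ ∈ s, g μ * (μ : ℂ) ^ j * cdot (f μ) (window L w₁ t) = 0) →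
          ∑ μ ∈ s, g μ * (μ : ℂ) ^ j = 0 := by
        intro j hj
        have h3 := hnext j hj k le_rfl
        rw [Finset.sum_eq_zero (fun μ _ => by rw [hz0 μ μ.2 k le_rfl, mul_zero]), zero_add] at h3
        exact (mul_eq_zero.1 h3).resolve_right (by exact_mod_cast hkne)
      intro j
      induction j with
      | zero =>
        have : ∀ t, k ≤ t → ∑ μ ∈ s, g μ * (μ : ℂ) ^ 0 * cdot (f μ) (window L w₁ t) = 0 := by
          intro t _
          have := congrArg (fun z => cdot z (window L w₁ t)) hg
          simpa [sum_cdot, smul_cdot] using this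
        exact ⟨this, hsum 0 this⟩
      | succ j ih =>
        have : ∀ t, k ≤ t →
            ∑ μ ∈ s, g μ * (μ : ℂ) ^ (j + 1) * cdot (f μ) (window L w₁ t) = 0 := by
          intro t ht
          have := hnext j ih.1 t ht
          rwa [ih.2, zero_mul, add_zero] at this
        exact ⟨this, hsum _ this⟩
    exact eq_zero_of_sum_mul_pow_eq_zero s (lam := fun μ : resonances S η => (μ : ℂ))
      Subtype.val_injective.injOn fun j => (key j).2
  exact Set.finite_coe_iff.1 hli.finite_of_isNoetherian

/-! ### Exponential output signals -/

/-- The output window of the signal `(0, μ^t v)`. -/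
def moment (L : ℕ) (x : ℝ × (Fin p → ℝ)) : Fin L × Fin p → ℝ := fun r => x.1 ^ (r.1 : ℕ) * x.2 r.2

/-- The signal `(0, μ^t v)`. -/
def modeSignal (m : ℕ) (x : ℝ × (Fin p → ℝ)) : Signal m p :=
  fun t => Sum.elim 0 (fun i => x.1 ^ t * x.2 i)

/-- A functional that kills all moments with exponents in G gives, for each output channel, a
polynomial in the exponent with infinitely many roots. -/
theorem exists_moment_notMem {U : Submodule ℝ (Fin L × Fin p → ℝ)} (hU : U ≠ ⊤) {G : Set ℝ}
    (hG : G.Infinite) : ∃ x : ℝ × (Fin p → ℝ), x.1 ∈ G ∧ moment L x ∉ U := by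
  classical
  by_contra! h
  obtain ⟨φ, hφ0, hφ⟩ := Submodule.exists_le_ker_of_lt_top U (lt_top_iff_ne_top.2 hU)
  refine hφ0 (LinearMap.pi_ext' fun r => LinearMap.ext_ring ?_)
  let q : Polynomial ℝ := ∑ k : Fin L, Polynomial.C (φ (Pi.single (k, r.2) 1)) * Polynomial.X ^ (k : ℕ)
  have hq : q = 0 := by
    refine Polynomial.eq_zero_of_infinite_isRoot q (hG.mono fun μ hμ => ?_)
    have h1 : φ (moment L (μ, Pi.single r.2 1)) = 0 := hφ (h (μ, Pi.single r.2 1) hμ)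
    have h2 : moment L (μ, Pi.single r.2 1) =
        ∑ k : Fin L, μ ^ (k : ℕ) • (Pi.single (k, r.2) 1 : Fin L × Fin p → ℝ) := by
      funext ⟨k, i⟩
      simp only [moment, Finset.sum_apply, Pi.smul_apply, smul_eq_mul]
      rw [Finset.sum_eq_single k (fun b _ hb => by simp [hb.symm]) (by simp)]
      simp [Pi.single_apply]
    rw [h2, map_sum] at h1
    rw [Set.mem_ofPred_eq, Polynomial.IsRoot, Polynomial.eval_finsetSum, ← h1]
    refine Finset.sum_congr rfl fun k _ => ?_
    rw [map_smul, smul_eq_mul, Polynomial.eval_mul, Polynomial.eval_C, Polynomial.eval_pow,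
      Polynomial.eval_X, mul_comm]
  have := congrArg (fun q => Polynomial.coeff q (r.1 : ℕ)) hq
  simpa [q, Polynomial.finsetSum_coeff, Polynomial.coeff_X_pow, Fin.val_inj] using this

/-- Exponential signals with distinct exponents outside of a finite set complement any space of
output windows; the `φ x` are the coordinate functionals. -/
theorem exists_modes (Y : Submodule ℝ (Fin L × Fin p → ℝ)) {F : Set ℝ} (hF : F.Finite) :
    ∃ (s : Finset (ℝ × (Fin p → ℝ))) (φ : ℝ × (Fin p → ℝ) → (Fin L × Fin p → ℝ) →ₗ[ℝ] ℝ),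
      (∀ x ∈ s, x.1 ∉ F) ∧ (∀ x ∈ s, ∀ y ∈ s, x.1 = y.1 → x = y) ∧
      (∀ x ∈ s, ∀ y ∈ Y, φ x y = 0) ∧
      (∀ x ∈ s, ∀ y ∈ s, φ x (moment L y) = if x = y then 1 else 0) ∧
      Y ⊔ Submodule.span ℝ (moment L '' s) = ⊤ := by
  classical
  -- Greedy choice of a basis of the quotient by Y: each new exponent avoids F and all exponents
  -- used so far.
  have hind : ∀ k ≤ Module.finrank ℝ ((Fin L × Fin p → ℝ) ⧸ Y),
      ∃ s : Finset (ℝ × (Fin p → ℝ)), s.card = k ∧ (∀ x ∈ s, x.1 ∉ F) ∧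
        (∀ x ∈ s, ∀ y ∈ s, x.1 = y.1 → x = y) ∧
        LinearIndepOn ℝ (fun x => Y.mkQ (moment L x)) (s : Set (ℝ × (Fin p → ℝ))) := by
    intro k
    induction k with
    | zero => exact fun _ => ⟨∅, by simp⟩
    | succ k ih =>
      intro hk
      obtain ⟨s, hcard, hsF, hinj, hli⟩ := ih (by omega)
      set W := Submodule.span ℝ ((fun x => Y.mkQ (moment L x)) '' (s : Set (ℝ × (Fin p → ℝ)))) with hW
      have hWtop : W ≠ ⊤ := by
        intro htop
        have h1 := finrank_span_finset_le_card (R := ℝ) (s.image (fun x => Y.mkQ (moment L x)))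
        rw [Set.finrank, Finset.coe_image, ← hW, htop, finrank_top] at h1
        have h2 := Finset.card_image_le (s := s) (f := fun x => Y.mkQ (moment L x))
        omega
      have hU : W.comap Y.mkQ ≠ ⊤ := by
        intro htop
        refine hWtop (eq_top_iff.2 fun z _ => ?_)
        obtain ⟨y, rfl⟩ := Y.mkQ_surjective z
        have : y ∈ W.comap Y.mkQ := htop ▸ Submodule.mem_top
        exact this
      obtain ⟨x, hx, hxU⟩ := exists_moment_notMem hU
        (Set.Finite.infinite_compl (hF.union (s.image Prod.fst).finite_toSet))
      simp only [Set.mem_compl_iff, Set.mem_union, not_or, Finset.coe_image, Set.mem_image,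
        not_exists, not_and, Finset.mem_coe] at hx
      have hxs : x ∉ s := fun h => hx.2 x h rfl
      refine ⟨insert x s, by rw [Finset.card_insert_of_notMem hxs, hcard], ?_, ?_, ?_⟩
      · intro y hy
        rcases Finset.mem_insert.1 hy with rfl | hy
        · exact hx.1
        · exact hsF y hy
      · intro y hy z hz hyz
        rcases Finset.mem_insert.1 hy with hy' | hy' <;> rcases Finset.mem_insert.1 hz with hz' | hz'
        · rw [hy', hz']
        · exact (hx.2 z hz' (hy' ▸ hyz.symm)).elim
        · exact (hx.2 y hy' (hz' ▸ hyz)).elim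
        · exact hinj y hy' z hz' hyz
      · rw [Finset.coe_insert]
        exact hli.insert hxU
  obtain ⟨s, hcard, hsF, hinj, hli⟩ := hind _ le_rfl
  have hspan : ⊤ ≤ Submodule.span ℝ
      (Set.range fun x : (s : Set (ℝ × (Fin p → ℝ))) => Y.mkQ (moment L (x : ℝ × (Fin p → ℝ)))) := by
    have := LinearIndependent.span_eq_top_of_card_eq_finrank' hli (by simp [hcard])
    exact this.ge
  let b := Module.Basis.mk hli hspan
  have hb : ∀ x : (s : Set (ℝ × (Fin p → ℝ))), b x = Y.mkQ (moment L x) := fun x => by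
    simp [b]
  refine ⟨s, fun x => if h : x ∈ (s : Set (ℝ × (Fin p → ℝ))) then b.coord ⟨x, h⟩ ∘ₗ Y.mkQ else 0,
    hsF, hinj, ?_, ?_, ?_⟩
  · intro x hx y hy
    beta_reduce
    rw [dif_pos (Finset.mem_coe.2 hx), LinearMap.comp_apply, Submodule.mkQ_apply,
      (Submodule.Quotient.mk_eq_zero Y).2 hy, map_zero]
  · intro x hx y hy
    beta_reduce
    rw [dif_pos (Finset.mem_coe.2 hx), LinearMap.comp_apply, ← hb ⟨y, hy⟩, Module.Basis.coord_apply,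
      Module.Basis.repr_self, Finsupp.single_apply]
    simp [eq_comm]
  · rw [eq_top_iff]
    intro y _
    have : Y.mkQ y ∈ (Submodule.span ℝ (moment L '' (s : Set (ℝ × (Fin p → ℝ))))).map Y.mkQ := by
      rw [Submodule.map_span, ← Set.image_comp]
      have h1 := hspan (Submodule.mem_top : Y.mkQ y ∈ ⊤)
      rw [← Set.image_eq_range (fun x => Y.mkQ (moment L x))] at h1
      exact h1
    obtain ⟨z, hz, hzy⟩ := this
    rw [Submodule.mem_sup]
    refine ⟨y - z, ?_, z, hz, sub_add_cancel y z⟩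
    rw [← Submodule.ker_mkQ Y, LinearMap.mem_ker, map_sub, hzy, sub_self]

/-! ### Monic difference equations for a space of signals -/

/-- `lastOutput` as a linear map. -/
def lastOutputMap (m L : ℕ) : (Fin p → ℝ) →ₗ[ℝ] (Fin (L + 1) × Var m p → ℝ) where
  toFun := lastOutput L
  map_add' := fun y y' => by
    funext ⟨k, a⟩
    by_cases h : k = Fin.last L <;> rcases a with a | a <;> simp [lastOutput, h]
  map_smul' := fun c y => by
    funext ⟨k, a⟩
    by_cases h : k = Fin.last L <;> rcases a with a | a <;> simp [lastOutput, h]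

@[simp] theorem lastOutputMap_apply (y : Fin p → ℝ) : lastOutputMap m L y = lastOutput L y := rfl

theorem isMonic_of_mulVec {R : Matrix (Fin p) (Fin (L + 1) × Var m p) ℝ}
    (h : ∀ y, R *ᵥ lastOutput L y = y) : IsMonic R := by
  intro i j
  have h1 : (lastOutput L (Pi.single j 1) : Fin (L + 1) × Var m p → ℝ) =
      Pi.single (Fin.last L, Sum.inr j) 1 := by
    funext ⟨k, a⟩
    by_cases h : k = Fin.last L <;> rcases a with a | a <;> simp [lastOutput, h, Pi.single_apply]
  have h2 := congrFun (h (Pi.single j 1)) i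
  rw [h1, mulVec_single_one] at h2
  simpa [Pi.single_apply, Matrix.one_apply] using h2

/-- The hypothesis says that on V the newest output is a linear function e of the rest of the
window. The equation "output minus prediction" is monic, since `rest` kills the newest output. -/
theorem exists_isMonic (V : Submodule ℝ (Signal m p))
    (h : ∀ w ∈ V, (∀ k < L, w k = 0) → (∀ i, w L (Sum.inl i) = 0) → w L = 0) :
    ∃ R : Matrix (Fin p) (Fin (L + 1) × Var m p) ℝ, IsMonic R ∧
      ∀ w ∈ V, R *ᵥ window (L + 1) w 0 = 0 := by
  let out : (Fin (L + 1) × Var m p → ℝ) →ₗ[ℝ] (Fin p → ℝ) :=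
    LinearMap.pi fun i => LinearMap.proj (Fin.last L, Sum.inr i)
  let rest : (Fin (L + 1) × Var m p → ℝ) →ₗ[ℝ] (Fin (L + 1) × Var m p → ℝ) :=
    LinearMap.id - lastOutputMap m L ∘ₗ out
  have hout : ∀ y : Fin p → ℝ, out (lastOutput L y) = y := by
    intro y
    funext i
    simp [out, lastOutput]
  have hrest : ∀ y : Fin p → ℝ, rest (lastOutput L y) = 0 := by
    intro y
    simp [rest, hout]
  obtain ⟨e, he⟩ := exists_comp_eq_of_ker_le ((rest ∘ₗ windowMap (L + 1) 0).domRestrict V)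
    ((out ∘ₗ windowMap (L + 1) 0).domRestrict V) (by
      rintro ⟨w, hw⟩ hz
      have hz' : window (L + 1) w 0 - lastOutput L (out (window (L + 1) w 0)) = 0 := hz
      have h0 : ∀ k < L, w k = 0 := by
        intro k hk
        funext a
        have h1 := congrFun hz' (⟨k, by omega⟩, a)
        have h2 : (⟨k, by omega⟩ : Fin (L + 1)) ≠ Fin.last L := by
          rw [Ne, Fin.ext_iff]
          simp only [Fin.val_last]
          omega
        simpa [window, lastOutput, h2] using h1
      have h1 : ∀ i, w L (Sum.inl i) = 0 := by
        intro i
        have h1 := congrFun hz' (Fin.last L, Sum.inl i)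
        simpa [window, lastOutput] using h1
      change out (window (L + 1) w 0) = 0
      funext i
      have := congrFun (h w hw h0 h1) (Sum.inr i)
      simpa [out, window] using this)
  refine ⟨LinearMap.toMatrix' (out - e ∘ₗ rest), isMonic_of_mulVec fun y => ?_, fun w hw => ?_⟩
  · rw [LinearMap.toMatrix'_mulVec]
    simp [hout, hrest]
  · rw [LinearMap.toMatrix'_mulVec]
    have := LinearMap.congr_fun he ⟨w, hw⟩
    exact sub_eq_zero.2 this.symm

theorem window_modeSignal (k t : ℕ) (x : ℝ × (Fin p → ℝ)) :
    window k (modeSignal m x) t = x.1 ^ t • window k (modeSignal m x) 0 := by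
  funext ⟨j, a⟩
  rcases a with a | a <;> simp [window, modeSignal, pow_add, mul_assoc]

/-- The outputs of a window. -/
def outputWindow (m p L : ℕ) : Signal m p →ₗ[ℝ] (Fin L × Fin p → ℝ) where
  toFun w := fun r => w r.1 (Sum.inr r.2)
  map_add' _ _ := rfl
  map_smul' _ _ := rfl

theorem outputWindow_modeSignal (x : ℝ × (Fin p → ℝ)) :
    outputWindow m p L (modeSignal m x) = moment L x := rfl

theorem outputWindow_mem {S : StateSpace m p n} {w : Signal m p} (hw : w ∈ S.behavior)
    (hu : ∀ t < L, ∀ i, w t (Sum.inl i) = 0) :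
    outputWindow m p L w ∈ LinearMap.range (S.observability L).mulVecLin := by
  obtain ⟨x, hx⟩ := hw
  refine (S.mem_range_observability L _).2 ⟨S.response (x 0) (fun _ => 0), S.response_mem _ _,
    fun _ _ => rfl, fun r => ?_⟩
  have := hx.eq_of_inputs_eq (S.isTrajectory_response (x 0) (fun _ => 0)) rfl (t := r.1)
    (fun s hs i => hu s (by omega) i)
  exact congrFun this _

/-- The moments are independent modulo the zero-input output windows of S. Hence a signal of the sum
that vanishes for L steps has no mode component, and the lag of S determines its next output. -/
theorem exists_isMonic_modes (S : StateSpace m p n) (hlag : S.lag ≤ L)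
    {s : Finset (ℝ × (Fin p → ℝ))} {φ : ℝ × (Fin p → ℝ) → (Fin L × Fin p → ℝ) →ₗ[ℝ] ℝ}
    (hφY : ∀ x ∈ s, ∀ y ∈ LinearMap.range (S.observability L).mulVecLin, φ x y = 0)
    (hφs : ∀ x ∈ s, ∀ y ∈ s, φ x (moment L y) = if x = y then 1 else 0) :
    ∃ R : Matrix (Fin p) (Fin (L + 1) × Var m p) ℝ, IsMonic R ∧
      (∀ w ∈ S.behavior, R *ᵥ window (L + 1) w 0 = 0) ∧
      ∀ x ∈ s, R *ᵥ window (L + 1) (modeSignal m x) 0 = 0 := by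
  classical
  obtain ⟨R, hR, hRV⟩ := exists_isMonic (L := L)
    (S.behaviorSubmodule ⊔ Submodule.span ℝ (modeSignal m '' (s : Set (ℝ × (Fin p → ℝ))))) (by
      intro w hw h0 hu
      obtain ⟨w₀, hw₀, w₁, hw₁, rfl⟩ := Submodule.mem_sup.1 hw
      obtain ⟨c, rfl⟩ := (Submodule.mem_span_image_finset_iff_exists_fun ℝ).1 hw₁
      have hinp : ∀ t i, (∑ x : s, c x • modeSignal m (x : ℝ × (Fin p → ℝ))) t (Sum.inl i) = 0 := by
        intro t i
        rw [Finset.sum_apply, Finset.sum_apply]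
        exact Finset.sum_eq_zero fun x _ => mul_zero _
      have hu₀ : ∀ t < L, ∀ i, w₀ t (Sum.inl i) = 0 := by
        intro t ht i
        have := congrFun (h0 t ht) (Sum.inl i)
        rw [Pi.add_apply, Pi.add_apply, hinp, add_zero] at this
        exact this
      have hY : outputWindow m p L (w₀ + ∑ x : s, c x • modeSignal m (x : ℝ × (Fin p → ℝ))) = 0 := by
        funext r
        exact congrFun (h0 r.1 r.1.2) (Sum.inr r.2)
      have hc0 : ∀ x : s, c x = 0 := by
        intro ⟨x, hx⟩
        have := congrArg (φ x) hY
        rw [map_add, map_add, hφY x hx _ (outputWindow_mem hw₀ hu₀), map_sum, map_sum, zero_add,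
          map_zero, Finset.sum_eq_single ⟨x, hx⟩] at this
        · rwa [map_smul, map_smul, outputWindow_modeSignal, hφs x hx x hx, if_pos rfl,
            smul_eq_mul, mul_one] at this
        · rintro ⟨y, hy⟩ _ hyx
          rw [map_smul, map_smul, outputWindow_modeSignal, hφs x hx y hy,
            if_neg (fun h => hyx (Subtype.ext h.symm)), smul_zero]
        · exact fun h => (h (Finset.mem_univ _)).elim
      rw [Finset.sum_eq_zero (fun x _ => by rw [hc0 x, zero_smul]), add_zero] at h0 hu ⊢
      exact S.eq_zero_of_lag_le hlag hw₀ h0 hu)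
  refine ⟨R, hR, fun w hw => hRV w (Submodule.mem_sup_left hw), fun x hx => hRV _ ?_⟩
  exact Submodule.mem_sup_right (Submodule.subset_span ⟨x, hx, rfl⟩)

/-! ### Rank-one perturbations of the difference equations -/

/-- The exceptional set is empty or a proper affine subspace, hence a null set. For c ≠ 0 this
includes g = 0. -/
theorem ae_linearMap_ne {ι E : Type*} [Fintype ι] [AddCommGroup E] [Module ℝ E]
    (g : (ι → ℝ) →ₗ[ℝ] E) {c : E} (h : g ≠ 0 ∨ c ≠ 0) : ∀ᵐ x : ι → ℝ, g x ≠ c := by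
  by_cases hex : ∃ x₀, g x₀ = c
  · obtain ⟨x₀, rfl⟩ := hex
    have hg : g ≠ 0 := by
      rintro rfl
      simp at h
    have hset : {x | ¬ g x ≠ g x₀} = (AffineSubspace.mk' x₀ (LinearMap.ker g) : Set (ι → ℝ)) := by
      ext x
      simp [AffineSubspace.mem_mk', LinearMap.mem_ker, sub_eq_zero]
    rw [ae_iff, hset]
    refine Measure.addHaar_affineSubspace _ _ fun htop => hg ?_
    have := congrArg AffineSubspace.direction htop
    rw [AffineSubspace.direction_mk', AffineSubspace.direction_top] at this
    exact LinearMap.ker_eq_top.1 this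
  · exact Filter.Eventually.of_forall fun x hx => hex ⟨x, hx⟩

/-- The difference equations `R w + α η(w) = 0`. -/
noncomputable def perturb (R : Matrix (Fin p) (Fin (L + 1) × Var m p) ℝ)
    (η : (Fin (L + 1) × Var m p → ℝ) →ₗ[ℝ] ℝ) (α : Fin p → ℝ) :
    Matrix (Fin p) (Fin (L + 1) × Var m p) ℝ :=
  R + LinearMap.toMatrix' (η.smulRight α)

theorem perturb_mulVec (R : Matrix (Fin p) (Fin (L + 1) × Var m p) ℝ)
    (η : (Fin (L + 1) × Var m p → ℝ) →ₗ[ℝ] ℝ) (α : Fin p → ℝ) (v : Fin (L + 1) × Var m p → ℝ) :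
    perturb R η α *ᵥ v = R *ᵥ v + η v • α := by
  rw [perturb, add_mulVec, LinearMap.toMatrix'_mulVec, LinearMap.smulRight_apply]

theorem IsMonic.perturb {R : Matrix (Fin p) (Fin (L + 1) × Var m p) ℝ} (hR : IsMonic R)
    {η : (Fin (L + 1) × Var m p → ℝ) →ₗ[ℝ] ℝ} (hη : ∀ y, η (lastOutput L y) = 0) (α : Fin p → ℝ) :
    IsMonic (perturb R η α) :=
  isMonic_of_mulVec fun y => by
    rw [perturb_mulVec, hR.mulVec_lastOutput, hη, zero_smul, add_zero]

/-- The first `L` samples of a window of length `L + 1`. -/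
def headMap (m p L : ℕ) : (Fin (L + 1) × Var m p → ℝ) →ₗ[ℝ] (Fin L × Var m p → ℝ) :=
  LinearMap.funLeft ℝ ℝ fun r => (r.1.castSucc, r.2)

/-- The last `L` samples of a window of length `L + 1`. -/
def tailMap (m p L : ℕ) : (Fin (L + 1) × Var m p → ℝ) →ₗ[ℝ] (Fin L × Var m p → ℝ) :=
  LinearMap.funLeft ℝ ℝ fun r => (r.1.succ, r.2)

theorem headMap_window (w : Signal m p) (t : ℕ) :
    headMap m p L (window (L + 1) w t) = window L w t := rfl

theorem tailMap_window (w : Signal m p) (t : ℕ) :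
    tailMap m p L (window (L + 1) w t) = window L w (t + 1) := by
  funext r
  simp [tailMap, LinearMap.funLeft_apply, window, add_assoc, add_comm 1]

theorem headMap_lastOutput (y : Fin p → ℝ) :
    headMap m p L (lastOutput L y) = 0 := by
  funext r
  simp [headMap, LinearMap.funLeft_apply, lastOutput, (Fin.castSucc_lt_last _).ne]

/-- The coefficient functional of `(σ - μ) f(σ)`. -/
noncomputable def shiftSub (μ : ℂ) (f : Fin L × Var m p → ℂ) :
    (Fin (L + 1) × Var m p → ℝ) →ₗ[ℝ] ℂ :=
  cdotMap f ∘ₗ tailMap m p L - μ • (cdotMap f ∘ₗ headMap m p L)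

theorem shiftSub_apply (μ : ℂ) (f : Fin L × Var m p → ℂ) (v : Fin (L + 1) × Var m p → ℝ) :
    shiftSub μ f v = cdot f (tailMap m p L v) - μ * cdot f (headMap m p L v) := rfl

theorem shiftSub_window (μ : ℂ) (f : Fin L × Var m p → ℂ) (w : Signal m p) :
    shiftSub μ f (window (L + 1) w 0) = cdot f (window L w 1) - μ * cdot f (window L w 0) := by
  rw [shiftSub_apply, tailMap_window, headMap_window]

/-- The set of all signals is controllable, so it admits no nonzero autonomous functional. -/
theorem eq_zero_of_shiftSub_eq_zero {μ : ℂ} {f : Fin L × Var m p → ℂ}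
    (h : ∀ v, shiftSub μ f v = 0) : f = 0 := by
  have hc : Controllable (Set.univ : Set (Signal m p)) := by
    intro w₁ _ w₂ _ t₁
    refine ⟨concat (t₁ + 1) w₁ w₂, trivial, t₁ + 1, by omega, fun t ht => ?_, fun t ht => ?_⟩
    · simp only [concat]
      rw [if_pos (by omega)]
    · simp only [concat]
      rw [if_neg (by omega)]
  refine eq_zero_of_cdot_eq_zero fun z => ?_
  have := cdot_window_eq_zero hc trivial (fun _ _ _ => trivial) (μ := μ) (f := f) (fun w _ => by
    rw [← sub_eq_zero, ← shiftSub_window, h]) (extendZero L z) trivial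
  rwa [window_extendZero] at this

/-- A functional that annihilates a monic behavior is a combination of its equations. -/
theorem IsMonic.shiftSub_eq_cdot {R : Matrix (Fin p) (Fin (L + 1) × Var m p) ℝ} (hR : IsMonic R)
    {μ : ℂ} {f : Fin L × Var m p → ℂ} (h : ∀ w ∈ kerBehavior R,
      cdot f (window L w 1) = μ * cdot f (window L w 0)) (v : Fin (L + 1) × Var m p → ℝ) :
    shiftSub μ f v =
      cdot (fun i => cdot f (tailMap m p L (lastOutput L (Pi.single i 1)))) (R *ᵥ v) := by
  have h0 : shiftSub μ f (v - lastOutput L (R *ᵥ v)) = 0 := by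
    obtain ⟨w, hw, hwv⟩ := hR.exists_mem_kerBehavior (hR.mulVec_sub_lastOutput v)
    rw [← hwv, shiftSub_window, h w hw, sub_self]
  rw [map_sub, sub_eq_zero] at h0
  rw [h0, shiftSub_apply, headMap_lastOutput, cdot_zero, mul_zero, sub_zero]
  exact (cdot_linearMap (cdotMap f ∘ₗ tailMap m p L ∘ₗ lastOutputMap m L) (R *ᵥ v)).symm

/-- The window with given outputs and with input zero. -/
def embedOutput (m p L : ℕ) : (Fin L × Fin p → ℝ) →ₗ[ℝ] (Fin L × Var m p → ℝ) where
  toFun y := fun r => Sum.elim (fun _ => 0) (fun i => y (r.1, i)) r.2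
  map_add' := fun y y' => by
    funext ⟨k, a⟩
    rcases a with a | a <;> simp
  map_smul' := fun c y => by
    funext ⟨k, a⟩
    rcases a with a | a <;> simp

/-- The output window that is zero except for the last output. -/
def lastUnit (L : ℕ) (i : Fin p) : Fin L × Fin p → ℝ :=
  fun r => if (r.1 : ℕ) + 1 = L then (Pi.single i 1 : Fin p → ℝ) r.2 else 0

theorem tailMap_lastOutput_single (i : Fin p) :
    tailMap m p L (lastOutput L (Pi.single i 1)) = embedOutput m p L (lastUnit L i) := by
  funext ⟨k, a⟩
  rcases a with a | a <;>
    simp [tailMap, LinearMap.funLeft_apply, lastOutput, embedOutput, lastUnit, Fin.ext_iff]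

theorem window_modeSignal_zero (x : ℝ × (Fin p → ℝ)) :
    window L (modeSignal m x) 0 = embedOutput m p L (moment L x) := by
  funext ⟨k, a⟩
  rcases a with a | a <;> simp [window, modeSignal, embedOutput, moment]

/-- The data of a perturbation argument: monic equations `R` that hold on a controllable behavior
and on finitely many exponential signals, whose moments complement the output windows of the
behavior and have the coordinate functionals `φ`. -/
structure ModeExtension (S : StateSpace m p n) (L : ℕ) where
  R : Matrix (Fin p) (Fin (L + 1) × Var m p) ℝ
  modes : Finset (ℝ × (Fin p → ℝ))
  φ : ℝ × (Fin p → ℝ) → (Fin L × Fin p → ℝ) →ₗ[ℝ] ℝ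
  isMonic : IsMonic R
  controllable : Controllable S.behavior
  mulVec_behavior : ∀ w ∈ S.behavior, R *ᵥ window (L + 1) w 0 = 0
  mulVec_mode : ∀ x ∈ modes, R *ᵥ window (L + 1) (modeSignal m x) 0 = 0
  fst_injOn : ∀ x ∈ modes, ∀ y ∈ modes, x.1 = y.1 → x = y
  φ_range : ∀ x ∈ modes, ∀ y ∈ LinearMap.range (S.observability L).mulVecLin, φ x y = 0
  φ_moment : ∀ x ∈ modes, ∀ y ∈ modes, φ x (moment L y) = if x = y then 1 else 0
  sup_eq_top : LinearMap.range (S.observability L).mulVecLin ⊔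
    Submodule.span ℝ (moment L '' (modes : Set (ℝ × (Fin p → ℝ)))) = ⊤

/-! ### Uncontrollable exponents of a mode extension and their generic removal -/

namespace ModeExtension

variable {S : StateSpace m p n}

theorem embedOutput_mem_of_mem_range {y : Fin L × Fin p → ℝ}
    (hy : y ∈ LinearMap.range (S.observability L).mulVecLin) :
    ∃ w ∈ S.behavior, window L w 0 = embedOutput m p L y := by
  obtain ⟨w, hw, hu, hv⟩ := (S.mem_range_observability L y).1 hy
  refine ⟨w, hw, funext fun r => ?_⟩
  obtain ⟨k, a | a⟩ := r
  · simp [window, embedOutput, hu]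
  · simp [window, embedOutput, hv]

/-- A functional that obeys an autonomous law on the behavior vanishes on its windows. -/
theorem cdot_eq_zero (E : ModeExtension S L) {μ : ℂ} {f : Fin L × Var m p → ℂ}
    (h : ∀ w ∈ S.behavior, shiftSub μ f (window (L + 1) w 0) = 0) :
    ∀ w ∈ S.behavior, cdot f (window L w 0) = 0 :=
  cdot_window_eq_zero E.controllable S.behaviorSubmodule.zero_mem (fun _ hw s => S.shift_mem hw s)
    (μ := μ) fun w hw => by rw [← sub_eq_zero, ← shiftSub_window, h w hw]

/-- A functional that vanishes on the windows of the behavior is determined by its output part. -/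
theorem eq_zero_of_embedOutput {f : Fin L × Var m p → ℂ}
    (h : ∀ w ∈ S.behavior, cdot f (window L w 0) = 0)
    (h' : ∀ y, cdot f (embedOutput m p L y) = 0) : f = 0 := by
  refine eq_zero_of_cdot_eq_zero fun z => ?_
  set w := S.response 0 (fun t i => extendZero L z t (Sum.inl i)) with hw
  have h1 : z = window L w 0 + embedOutput m p L (fun r => (z - window L w 0) (r.1, Sum.inr r.2)) := by
    funext ⟨k, a⟩
    rcases a with a | a
    · simp [embedOutput, hw, window, StateSpace.response, extendZero]
    · simp [embedOutput]
  rw [h1, cdot_add, h w (S.response_mem _ _), h', add_zero]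

theorem linearMap_eq_zero (E : ModeExtension S L) {g : (Fin L × Fin p → ℝ) →ₗ[ℝ] ℂ}
    (h : ∀ y ∈ LinearMap.range (S.observability L).mulVecLin, g y = 0)
    (h' : ∀ x ∈ E.modes, g (moment L x) = 0) : g = 0 := by
  rw [← LinearMap.ker_eq_top, eq_top_iff, ← E.sup_eq_top]
  refine sup_le h (Submodule.span_le.2 ?_)
  rintro _ ⟨x, hx, rfl⟩
  exact h' x hx

/-- On an exponential with exponent x.1, the operator σ - μ acts as multiplication by x.1 - μ. -/
theorem cdot_mode_eq_zero {μ : ℂ} {f : Fin L × Var m p → ℂ} {x : ℝ × (Fin p → ℝ)}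
    (h : shiftSub μ f (window (L + 1) (modeSignal m x) 0) = 0) (hx : (x.1 : ℂ) ≠ μ) :
    cdot f (embedOutput m p L (moment L x)) = 0 := by
  rw [shiftSub_window, window_modeSignal L 1, pow_one, cdot_smul, ← sub_mul,
    window_modeSignal_zero] at h
  exact (mul_eq_zero.1 h).resolve_left (sub_ne_zero.2 hx)

/-- Controllability makes f vanish on the windows of the behavior, the exponent gap makes it vanish
on the modes, and together these span all windows. -/
theorem eq_zero_of_notMem_modes (E : ModeExtension S L) {μ : ℂ} {f : Fin L × Var m p → ℂ}
    (h : ∀ w ∈ S.behavior, shiftSub μ f (window (L + 1) w 0) = 0)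
    (h' : ∀ x ∈ E.modes, shiftSub μ f (window (L + 1) (modeSignal m x) 0) = 0)
    (hμ : ∀ x ∈ E.modes, (x.1 : ℂ) ≠ μ) : f = 0 := by
  have h0 := E.cdot_eq_zero h
  have hg : cdotMap f ∘ₗ embedOutput m p L = 0 := by
    refine E.linearMap_eq_zero (fun y hy => ?_) (fun x hx => cdot_mode_eq_zero (h' x hx) (hμ x hx))
    obtain ⟨w, hw, hwy⟩ := embedOutput_mem_of_mem_range hy
    rw [LinearMap.comp_apply, ← hwy]
    exact h0 w hw
  exact eq_zero_of_embedOutput h0 fun y => LinearMap.congr_fun hg y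

/-- A functional that obeys the law of one of the modes is a multiple of its coordinate. -/
theorem cdot_embedOutput_eq (E : ModeExtension S L) {f : Fin L × Var m p → ℂ}
    {x : ℝ × (Fin p → ℝ)} (hx : x ∈ E.modes)
    (h : ∀ w ∈ S.behavior, shiftSub (x.1 : ℂ) f (window (L + 1) w 0) = 0)
    (h' : ∀ y ∈ E.modes, shiftSub (x.1 : ℂ) f (window (L + 1) (modeSignal m y) 0) = 0)
    (y : Fin L × Fin p → ℝ) : cdot f (embedOutput m p L y) =
      cdot f (embedOutput m p L (moment L x)) * (E.φ x y : ℂ) := by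
  have h0 := E.cdot_eq_zero h
  have hg : cdotMap f ∘ₗ embedOutput m p L - cdot f (embedOutput m p L (moment L x)) •
      (Complex.ofRealLI.toLinearMap ∘ₗ E.φ x) = 0 := by
    refine E.linearMap_eq_zero (fun y hy => ?_) (fun y hy => ?_)
    · obtain ⟨w, hw, hwy⟩ := embedOutput_mem_of_mem_range hy
      change cdot f (embedOutput m p L y) - _ * ((E.φ x y : ℝ) : ℂ) = 0
      rw [← hwy, h0 w hw, E.φ_range x hx y hy]
      simp
    · change cdot f (embedOutput m p L (moment L y)) - _ * ((E.φ x (moment L y) : ℝ) : ℂ) = 0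
      rw [E.φ_moment x hx y hy]
      by_cases hxy : x = y
      · subst hxy
        simp
      · rw [if_neg hxy, cdot_mode_eq_zero (h' y hy)
          (fun hc => hxy (E.fst_injOn x hx y hy (by exact_mod_cast hc.symm)))]
        simp
  exact sub_eq_zero.1 (LinearMap.congr_fun hg y)

/-- The directions `α` for which the perturbed equations have no uncontrollable exponent. -/
def IsGood (E : ModeExtension S L) (η : (Fin (L + 1) × Var m p → ℝ) →ₗ[ℝ] ℝ) (α : Fin p → ℝ) :
    Prop :=
  -- A functional that obeys the law of mode x has equation coefficients a proportional to this
  -- vector; a · α ≠ 0 means that the perturbation breaks the law.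
  (∀ x ∈ E.modes, (fun i => (E.φ x (lastUnit L i) : ℂ)) ≠ 0 →
    cdot (fun i => (E.φ x (lastUnit L i) : ℂ)) α ≠ 0) ∧
  -- If a · α = -1, then a · (R + α η) equals a · R - η, so f would obey an autonomous law on the
  -- perturbed behavior.
  ∀ μ ∈ resonances S η, ∀ (f : Fin L × Var m p → ℂ) (a : Fin p → ℂ),
    (∀ v, shiftSub μ f v = cdot a (E.R *ᵥ v) - (η v : ℂ)) → cdot a α ≠ -1

theorem cdotMap_ne_zero {ι : Type*} [Fintype ι] {a : ι → ℂ} (ha : a ≠ 0) : cdotMap a ≠ 0 :=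
  fun h => ha (eq_zero_of_cdot_eq_zero fun z => LinearMap.congr_fun h z)

theorem ae_isGood (E : ModeExtension S L) {η : (Fin (L + 1) × Var m p → ℝ) →ₗ[ℝ] ℝ}
    (hfin : (resonances S η).Finite) (hres : ∀ x ∈ E.modes, (x.1 : ℂ) ∉ resonances S η) :
    ∀ᵐ α, E.IsGood η α := by
  have h1 : ∀ᵐ α : Fin p → ℝ, ∀ x ∈ (E.modes : Set (ℝ × (Fin p → ℝ))),
      (fun i => (E.φ x (lastUnit L i) : ℂ)) ≠ 0 →
      cdot (fun i => (E.φ x (lastUnit L i) : ℂ)) α ≠ 0 := by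
    refine (ae_ball_iff E.modes.countable_toSet).2 fun x _ => ?_
    by_cases hx : (fun i => (E.φ x (lastUnit L i) : ℂ)) = 0
    · exact Filter.Eventually.of_forall fun _ h => (h hx).elim
    · filter_upwards [ae_linearMap_ne _ (Or.inl (cdotMap_ne_zero hx))] with α hα _ using hα
  have h2 : ∀ᵐ α : Fin p → ℝ, ∀ μ ∈ resonances S η, ∀ (f : Fin L × Var m p → ℂ) (a : Fin p → ℂ),
      (∀ v, shiftSub μ f v = cdot a (E.R *ᵥ v) - (η v : ℂ)) → cdot a α ≠ -1 := by
    refine (ae_ball_iff hfin.countable).2 fun μ hμ => ?_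
    by_cases hex : ∃ (f : Fin L × Var m p → ℂ) (a : Fin p → ℂ),
        ∀ v, shiftSub μ f v = cdot a (E.R *ᵥ v) - (η v : ℂ)
    · obtain ⟨f₀, a₀, h₀⟩ := hex
      filter_upwards [ae_linearMap_ne (cdotMap a₀) (c := -1) (Or.inr (by simp))] with α hα
      intro f a h
      -- At a resonance the pair (f, a) is unique, because μ is not a mode exponent and R is monic.
      -- So a single affine condition on α has to be avoided.
      have hsub : ∀ v, shiftSub μ (f - f₀) v = cdot (a - a₀) (E.R *ᵥ v) := by
        intro v
        rw [sub_cdot]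
        have e1 := h v
        have e2 := h₀ v
        rw [shiftSub_apply] at e1 e2 ⊢
        rw [sub_cdot, sub_cdot]
        linear_combination e1 - e2
      have hff : f - f₀ = 0 := E.eq_zero_of_notMem_modes
        (fun w hw => by rw [hsub, E.mulVec_behavior w hw, cdot_zero])
        (fun x hx => by rw [hsub, E.mulVec_mode x hx, cdot_zero])
        (fun x hx hxμ => hres x hx (hxμ ▸ hμ))
      have haa : a - a₀ = 0 := eq_zero_of_cdot_eq_zero fun y => by
        have := hsub (lastOutput L y)
        rw [E.isMonic.mulVec_lastOutput, hff] at this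
        rw [← this]
        simp [shiftSub_apply]
      rw [sub_eq_zero.1 haa]
      exact hα
    · exact Filter.Eventually.of_forall fun α f a h => (hex ⟨f, a, h⟩).elim
  filter_upwards [h1, h2] with α h1 h2 using ⟨h1, h2⟩

/-- An autonomous functional of the perturbed equations is a combination a of them, so the term η(v)
(a · α) measures its deviation from a law of the unperturbed system. -/
theorem controllable_perturb (E : ModeExtension S L)
    {η : (Fin (L + 1) × Var m p → ℝ) →ₗ[ℝ] ℝ} (hη : ∀ y, η (lastOutput L y) = 0)
    {α : Fin p → ℝ} (hα : E.IsGood η α) :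
    Controllable (kerBehavior (perturb E.R η α) : Set (Signal m p)) := by
  have hR := E.isMonic.perturb hη α
  refine hR.controllable fun μ f hf => ?_
  set a : Fin p → ℂ := fun i => cdot f (tailMap m p L (lastOutput L (Pi.single i 1))) with ha
  have hG : ∀ v, shiftSub μ f v = cdot a (E.R *ᵥ v) + (η v : ℂ) * cdot a α := by
    intro v
    rw [hR.shiftSub_eq_cdot hf, perturb_mulVec, cdot_add, cdot_smul]
  -- If a · α = 0, then f obeys its law already on the behavior and the modes. Otherwise, dividing
  -- by a · α exhibits μ as a resonance and yields the forbidden pair.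
  by_cases hθ : cdot a α = 0
  · have h1 : ∀ w ∈ S.behavior, shiftSub μ f (window (L + 1) w 0) = 0 := fun w hw => by
      rw [hG, E.mulVec_behavior w hw, hθ, cdot_zero, mul_zero, add_zero]
    have h2 : ∀ x ∈ E.modes, shiftSub μ f (window (L + 1) (modeSignal m x) 0) = 0 := fun x hx => by
      rw [hG, E.mulVec_mode x hx, hθ, cdot_zero, mul_zero, add_zero]
    by_cases hμ : ∀ x ∈ E.modes, (x.1 : ℂ) ≠ μ
    · exact E.eq_zero_of_notMem_modes h1 h2 hμ
    push Not at hμ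
    obtain ⟨x, hx, rfl⟩ := hμ
    have h3 := E.cdot_embedOutput_eq hx h1 h2
    set c := cdot f (embedOutput m p L (moment L x)) with hc
    have hab : a = c • fun i => (E.φ x (lastUnit L i) : ℂ) := by
      funext i
      rw [Pi.smul_apply, smul_eq_mul, ← h3, ← tailMap_lastOutput_single]
    by_cases hb : (fun i => (E.φ x (lastUnit L i) : ℂ)) = 0
    · refine eq_zero_of_shiftSub_eq_zero (μ := (x.1 : ℂ)) fun v => ?_
      rw [hG, hθ, hab, hb, smul_zero, zero_cdot, mul_zero, add_zero]
    · rw [hab, smul_cdot] at hθ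
      have hc0 := (mul_eq_zero.1 hθ).resolve_right (hα.1 x hx hb)
      exact eq_zero_of_embedOutput (E.cdot_eq_zero h1) fun y => by rw [h3, hc0, zero_mul]
  · exfalso
    have hμ : μ ∈ resonances S η := by
      refine ⟨(cdot a α)⁻¹ • f, fun w hw => ?_⟩
      have := hG (window (L + 1) w 0)
      rw [shiftSub_window, E.mulVec_behavior w hw, cdot_zero, zero_add] at this
      rw [smul_cdot, smul_cdot]
      field_simp
      linear_combination this
    refine hα.2 μ hμ (-(cdot a α)⁻¹ • f) (-(cdot a α)⁻¹ • a) (fun v => ?_) ?_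
    · have := hG v
      rw [shiftSub_apply] at this ⊢
      rw [smul_cdot, smul_cdot, smul_cdot]
      field_simp
      linear_combination -this
    · rw [smul_cdot, neg_mul, inv_mul_cancel₀ hθ]

end ModeExtension

/-- Every controllable behavior of bounded lag has a mode extension that avoids given exponents. -/
theorem exists_modeExtension (S : StateSpace m p n) (hlag : S.lag ≤ L)
    (hc : Controllable S.behavior) {F : Set ℂ} (hF : F.Finite) :
    ∃ E : ModeExtension S L, ∀ x ∈ E.modes, (x.1 : ℂ) ∉ F := by
  obtain ⟨s, φ, hsF, hinj, hφY, hφs, htop⟩ :=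
    exists_modes (LinearMap.range (S.observability L).mulVecLin)
      (hF.preimage (f := fun x : ℝ => (x : ℂ)) Complex.ofReal_injective.injOn)
  obtain ⟨R, hR, hRB, hRs⟩ := exists_isMonic_modes S hlag hφY hφs
  exact ⟨⟨R, s, φ, hR, hc, hRB, hRs, hinj, hφY, hφs, htop⟩, hsF⟩

/-! ### Necessity of the rank condition -/

/-- Slack that is nonnegative on all signals forces a nonnegative static supply rate. -/
theorem posSemidef_of_slack_nonneg {Φ : Coeff m p 1} (hΦ : Φ.IsHermitian) {Ψ : Coeff m p L}
    (hΨ : Ψ.PosSemidef) (h : ∀ v, 0 ≤ v ⬝ᵥ (slack Φ Ψ *ᵥ v)) : Φ.PosSemidef := by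
  refine PosSemidef.of_dotProduct_mulVec_nonneg hΦ fun v => ?_
  rw [star_trivial]
  -- An impulse at time L: the storage starts at zero and the summed supply equals the quadratic
  -- form of Φ at v, which bounds the nonnegative final storage from above.
  let w : Signal m p := fun t => if t = L then fun a => v (0, a) else 0
  have hsum : ∀ k, qdf Ψ w k ≤ qdf Ψ w 0 + ∑ t ∈ Finset.range k, qdf Φ w t := by
    intro k
    induction k with
    | zero => simp
    | succ k ih =>
      have := h (window (L + 1) w k)
      change 0 ≤ qdf (slack Φ Ψ) w k at this
      rw [qdf_slack (by omega)] at this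
      rw [Finset.sum_range_succ]
      linarith
  have hL := hsum (L + 1)
  have h0 : qdf Ψ w 0 = 0 := by
    have : window L w 0 = 0 := window_eq_zero_iff.2 fun j hj => by
      simp only [w, zero_add]
      rw [if_neg hj.ne]
    rw [qdf, this, zero_dotProduct]
  have hv : window 1 w L = v := by
    funext ⟨k, a⟩
    obtain rfl : k = 0 := Subsingleton.elim _ _
    simp [window, w]
  rw [h0, zero_add, Finset.sum_eq_single L] at hL
  · have hΦL : qdf Φ w L = v ⬝ᵥ Φ *ᵥ v := by rw [qdf, hv]
    exact ((qdf_nonneg hΨ w _).trans hL).trans_eq hΦL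
  · intro t _ ht
    have : window 1 w t = 0 := window_eq_zero_iff.2 fun j hj => by
      obtain rfl : j = 0 := by omega
      simp only [w, add_zero]
      rw [if_neg ht]
    rw [qdf, this, zero_dotProduct]
  · simp

theorem continuous_quadraticForm {ι : Type*} [Fintype ι] (M : Matrix ι ι ℝ) :
    Continuous fun v : ι → ℝ => v ⬝ᵥ (M *ᵥ v) :=
  continuous_id.dotProduct (continuous_const.matrix_mulVec continuous_id)

/-- A quadratic form that is nonnegative on the kernels of almost all perturbations of monic
equations is nonnegative. -/
theorem nonneg_of_ae_perturb {R : Matrix (Fin p) (Fin (L + 1) × Var m p) ℝ} (hR : IsMonic R)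
    {η : (Fin (L + 1) × Var m p → ℝ) →ₗ[ℝ] ℝ} (hη : ∀ y, η (lastOutput L y) = 0) (hη0 : η ≠ 0)
    {M : Coeff m p (L + 1)}
    (h : ∀ᵐ α, ∀ v, perturb R η α *ᵥ v = 0 → 0 ≤ v ⬝ᵥ (M *ᵥ v)) (v : Fin (L + 1) × Var m p → ℝ) :
    0 ≤ v ⬝ᵥ (M *ᵥ v) := by
  have key : ∀ v, η v ≠ 0 → 0 ≤ v ⬝ᵥ (M *ᵥ v) := by
    intro v hv
    -- Correcting only the newest output moves v into the kernel of the perturbed equations,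
    -- continuously in α; at α = -R v / η(v) no correction is needed.
    let e : (Fin p → ℝ) → Fin (L + 1) × Var m p → ℝ := fun α => v - lastOutput L (R *ᵥ v + η v • α)
    have hcont : Continuous e := by
      have h1 : Continuous (lastOutputMap m L : (Fin p → ℝ) →ₗ[ℝ] _) :=
        LinearMap.continuous_of_finiteDimensional _
      have h2 : Continuous fun α : Fin p → ℝ => R *ᵥ v + η v • α := by fun_prop
      exact continuous_const.sub (h1.comp h2)
    have hclosed : IsClosed {α | 0 ≤ e α ⬝ᵥ (M *ᵥ e α)} :=
      isClosed_le continuous_const ((continuous_quadraticForm M).comp hcont)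
    have hsub : {α | ∀ v, perturb R η α *ᵥ v = 0 → 0 ≤ v ⬝ᵥ (M *ᵥ v)} ⊆
        {α | 0 ≤ e α ⬝ᵥ (M *ᵥ e α)} := by
      intro α hα
      refine hα (e α) ?_
      simp only [e]
      rw [← perturb_mulVec]
      exact (hR.perturb hη α).mulVec_sub_lastOutput v
    have hall : 0 ≤ e (-(η v)⁻¹ • R *ᵥ v) ⬝ᵥ (M *ᵥ e (-(η v)⁻¹ • R *ᵥ v)) :=
      hclosed.closure_subset_iff.2 hsub (Measure.dense_of_ae h _)
    have hev : e (-(η v)⁻¹ • R *ᵥ v) = v := by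
      simp only [e]
      rw [smul_smul, mul_neg, mul_inv_cancel₀ hv, neg_smul, one_smul, add_neg_cancel,
        ← lastOutputMap_apply, map_zero, sub_zero]
    rwa [hev] at hall
  have hclosed : IsClosed {v | 0 ≤ v ⬝ᵥ (M *ᵥ v)} :=
    isClosed_le continuous_const (continuous_quadraticForm M)
  have hdense := Measure.dense_of_ae (ae_linearMap_ne η (c := 0) (Or.inl hη0))
  exact hclosed.closure_subset_iff.2 (fun v hv => key v hv) (hdense v)

theorem windowSpace_le_range_hankel {T : ℕ} {data : Fin T → Var m p → ℝ} (hT : L + 1 ≤ T)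
    (S : StateSpace m p n) (hdata : data ∈ restrict T S.behavior) (hlag : S.lag ≤ L)
    (hc : Controllable S.behavior) {Φ : Coeff m p 1} (hΦ : Φ.IsHermitian)
    (hΦneg : ¬ Φ.PosSemidef) {Ψ : Coeff m p L} (hΨ : Ψ.PosSemidef)
    (h : ∀ 𝔅 ∈ consistent data ∩ LTIContLag m p L, DissipationIneq 𝔅 Φ Ψ) :
    S.windowSpace (L + 1) ≤ LinearMap.range (hankel data (L + 1) hT).mulVecLin := by
  by_contra hle
  obtain ⟨v, hvS, hvH⟩ := SetLike.not_le_iff_exists.1 hle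
  obtain ⟨η, hηv, hηH⟩ := Submodule.exists_le_ker_of_notMem hvH
  obtain ⟨w₀, hw₀, rfl⟩ := hvS
  rw [windowMap_apply] at hηv
  have hfin := finite_resonances S hc η ⟨w₀, hw₀, hηv⟩
  obtain ⟨E, hE⟩ := exists_modeExtension S hlag hc hfin
  -- Subtracting a multiple of the equations removes the newest output from η, so that perturbations
  -- stay monic. On the behavior, and hence for the resonances, nothing changes.
  let η₀ : (Fin (L + 1) × Var m p → ℝ) →ₗ[ℝ] ℝ :=
    η - η ∘ₗ lastOutputMap m L ∘ₗ E.R.mulVecLin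
  have hη₀ : ∀ v, η₀ v = η v - η (lastOutput L (E.R *ᵥ v)) := fun _ => rfl
  have hη₀B : ∀ w ∈ S.behavior, η₀ (window (L + 1) w 0) = η (window (L + 1) w 0) := by
    intro w hw
    rw [hη₀, E.mulVec_behavior w hw, ← lastOutputMap_apply, map_zero, map_zero, sub_zero]
  have hη₀out : ∀ y, η₀ (lastOutput L y) = 0 := by
    intro y
    rw [hη₀, E.isMonic.mulVec_lastOutput, sub_self]
  have hres : resonances S η₀ = resonances S η := by
    ext μ
    refine exists_congr fun f => forall₂_congr fun w hw => ?_
    rw [hη₀B w hw]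
  have hη₀ne : η₀ ≠ 0 := by
    intro h0
    rw [← hη₀B w₀ hw₀, h0] at hηv
    exact hηv rfl
  refine hΦneg (posSemidef_of_slack_nonneg hΦ hΨ
    (nonneg_of_ae_perturb E.isMonic hη₀out hη₀ne ?_))
  filter_upwards [E.ae_isGood (η := η₀) (hres ▸ hfin) (hres ▸ hE)] with α hα
  have hmonic := E.isMonic.perturb hη₀out α
  have hcontr := E.controllable_perturb hη₀out hα
  obtain ⟨k, S', hS'⟩ := hmonic.exists_stateSpace
  have hmem : (kerBehavior (perturb E.R η₀ α) : Set (Signal m p)) ∈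
      consistent data ∩ LTIContLag m p L := by
    refine ⟨⟨⟨k, S', hS'⟩, ?_⟩, ⟨k, S', hS'⟩, hcontr, ?_⟩
    · obtain ⟨w, hw, hwd⟩ := hdata
      -- On data windows both R and η vanish, so the data satisfy the perturbed equations for every
      -- α and extend to a full solution.
      obtain ⟨w', hw', hww'⟩ := hmonic.exists_extension (w := w) hT (fun t ht => by
        rw [← window_shift_zero, perturb_mulVec, hη₀B _ (S.shift_mem hw t),
          E.mulVec_behavior _ (S.shift_mem hw t), window_shift_zero]
        have hcol := hankel_col hwd hT ⟨t, by omega⟩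
        have : η (window (L + 1) w t) = 0 := by
          rw [← LinearMap.mem_ker]
          apply hηH
          rw [range_mulVecLin, ← hcol]
          exact Submodule.subset_span ⟨_, rfl⟩
        rw [this, zero_smul, add_zero])
      exact ⟨w', hw', fun t => by rw [hwd, hww' t t.2]⟩
    · rw [← hS', lag_behavior]
      exact hmonic.lag_le S' hS'
  intro v hv
  obtain ⟨w, hw, rfl⟩ := hmonic.exists_mem_kerBehavior hv
  exact (qdf_nabla_le_iff (by omega) Φ Ψ w 0).1 (h _ hmem w hw 0)

theorem not_posSemidef_of_hasInertia {ι : Type} [Fintype ι] [DecidableEq ι] {M : Matrix ι ι ℝ}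
    {a b c : ℕ} (h : HasInertia M a b c) (ha : 1 ≤ a) : ¬ M.PosSemidef := by
  intro hM
  obtain ⟨hH, hcard, -, -⟩ := h
  have : IsEmpty {i // hH.eigenvalues i < 0} :=
    ⟨fun i => (hM.eigenvalues_nonneg i.1).not_gt i.2⟩
  rw [Nat.card_of_isEmpty] at hcard
  omega

end DataDissipativity

theorem theorem3 (m p : ℕ) (hm : 1 ≤ m) (hp : 1 ≤ p) (L T : ℕ)
    (Bstar : Set (Signal m p)) (hBstar : Bstar ∈ LTIContLag m p L)
    (data : Fin T → Var m p → ℝ) (hdata : data ∈ restrict T Bstar) :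
    -- part (i)
    (∀ (N : ℕ) (Φ : Coeff m p N), IsMinimalCoeff Φ →
      ∀ (d : ℕ), (d : ℤ) = max (qdfDegree Φ) (L : ℤ) → ∀ (hT : d + 1 ≤ T),
        (hankel data (d + 1) hT).rank = nMin data + m * (d + 1) →
        ∀ Ψ : Coeff m p d, Ψ.PosSemidef → DataLMI (hankel data (d + 1) hT) Φ Ψ →
          Informative L Φ data ∧ IsStorage Bstar Φ Ψ) ∧
    -- part (ii)
    (∀ Φ : Coeff m p 1, IsMinimalCoeff Φ → qdfDegree Φ = 0 →
      HasInertia Φ p 0 m → (-outputBlock Φ).PosSemidef → ∀ (hT : L + 1 ≤ T),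
        (Informative L Φ data ↔
          (hankel data (L + 1) hT).rank = nMin data + m * (L + 1) ∧
          ∃ Ψ : Coeff m p L, Ψ.PosSemidef ∧ DataLMI (hankel data (L + 1) hT) Φ Ψ)) := by
  have hmem : Bstar ∈ consistent data ∩ LTIContLag m p L := ⟨⟨hBstar.1, hdata⟩, hBstar⟩
  refine ⟨fun N Φ hΦ d hd hT hrank Ψ hΨ hLMI => ?_, fun Φ hΦ hdeg hin _ hT => ?_⟩
  · obtain ⟨h1, h2⟩ := informative_of_dataLMI hT hrank hΦ hd hΨ hLMI
    exact ⟨h2, hΨ.1, fun w _ t => qdf_nonneg hΨ w t, h1 Bstar hmem⟩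
  -- A static supply rate has degree 0 ≤ L, so the horizon d is L.
  · have hd : (L : ℤ) = max (qdfDegree Φ) (L : ℤ) := by omega
    constructor
    · intro hinf
      obtain ⟨Ψ, hΨ, h⟩ := (informative_iff hd data).1 hinf
      obtain ⟨⟨n, S, rfl⟩, hc, hlag⟩ := hBstar
      rw [lag_behavior] at hlag
      exact ⟨rank_hankel_eq hT S hdata hlag (windowSpace_le_range_hankel hT S hdata hlag hc hΦ.1
        (not_posSemidef_of_hasInertia hin hp) hΨ h),
        Ψ, hΨ, dataLMI_of_dissipationIneq hT (by omega) hΦ.1 hΨ.1 S hdata (h _ hmem)⟩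
    · rintro ⟨hrank, Ψ, hΨ, hLMI⟩
      exact (informative_of_dataLMI hT hrank hΦ hd hΨ hLMI).2
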